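/- **Setting.** Fix a number $K\ge 1$ of arms. On an instance $P=(P_1,\dots,P_K)\in\mathbb R^K$, sampling arm $i$ yields an independent Gaussian reward with mean $P_i$ and variance $1$. Write $i^*(P)=\arg\max_i P_i$ (a set). An algorithm (which may use the budget $T$) chooses the arm of each of the rounds $1,\dots,T$ as a measurable function of the past observations, and then recommends an arm $J(T)$ as a measurable function of all $T$ observations; $\mathrm{PoE}_{\mathcal A}(P)=\mathbb P_P[J(T)\notin i^*(P)]$. Let $H:\mathbb R^K\to(0,\infty]$ be an arbitrary risk measure (only its values at $P$ with $|i^*(P)|=1$ matter). The rate of $\mathcal A$ is $$R_{\mathcal A}=\inf_{P:\,|i^*(P)|=1}H(P)\,\liminf_{T\to\infty}\frac1T\log\frac1{\mathrm{PoE}_{\mathcal A}(P)}\in[0,\infty],$$ and the value of the one-shot game is $$R^{\mathrm{go}}=\sup_{w}\ \inf_{\substack{P,Q\in\mathbb R^K:\ |i^*(P)|=1,\\ i^*(P)\not\subseteq i^*(Q)}}H(P)\sum_{i=1}^K w_i(Q)\,\frac{(Q_i-P_i)^2}{2},$$ the supremum being over measurable maps $w$ from $\mathbb R^K$ to the probability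 simplex of $\mathbb R^K$; a maximiser is called an optimal allocation. Here $\log(1/0)=\infty$, $\inf\emptyset=\infty$, and $\infty\cdot x=\infty$ for all $x\in[0,\infty]$, so that instances with $H(P)=\infty$ impose no constraint. **Pooled Allocation** with allocation $w$ and $B=B(T)$ batches of $n=\lfloor T/B\rfloor$ rounds: batch $i\le K$ draws only arm $i$, and $Q^{\mathrm{pool}}_1$ is the vector of the resulting empirical means. For $b=K+1,\dots,B$, put $w_b=w(Q^{\mathrm{pool}}_{b-K})$, draw each arm $i$ in batch $b$ for $\lceil w_{b,i}(n-K)^+\rceil$ rounds (that is, $w_{b,i}n$ rounded so that the total is at most $n$), let $Q_{b,i}$ be the empirical mean of these draws ($0$ if there are none), and set $Q^{\mathrm{pool}}_{b-K+1,i}=(1-w_{b,i})Q^{\mathrm{pool}}_{b-K,i}+w_{b,i}Q_{b,i}$; observations in rounds left over are ignored. The arm recommended is one that is most often the (least-index) best arm among $Q^{\mathrm{pool}}_1,\dots,Q^{\mathrm{pool}}_{B-K}$. A batch schedule is a function $B$ with $B(T)\to\infty$ and $B(T)=o(T)$ as $T\to\infty$ (with $K$ fixed this is $K=o(B)$, $KB=o(T)$,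 and $K^2=o(T)$ holds automatically). **Theorem.** (1) There is an algorithm $\mathcal A$, namely Pooled Allocation with some optimal allocation and some batch schedule, such that $(R^{\mathrm{go}}-\varepsilon)/2\le R_{\mathcal A}$ for every $\varepsilon>0$; consequently $R^{\mathrm{go}}/2\le R_{\mathcal A}\le R^{\mathrm{go}}$. In particular an optimal allocation exists. (2) For every optimal allocation and every batch schedule, Pooled Allocation satisfies $R_{\mathrm{Pooled\ Allocation}}\ge R^{\mathrm{go}}/2-\varepsilon$ for every $\varepsilon>0$. -/

import Mathlib

open MeasureTheory ProbabilityTheory Filter Asymptotics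
open scoped ENNReal NNReal

noncomputable section

namespace BestArm

variable {K : ℕ}

/-! ### Instances, risk and the one-shot game -/

/-- `i` belongs to the set of best arms `i*(P)` of the mean vector `P`. -/
def IsBest (P : Fin K → ℝ) (i : Fin K) : Prop := ∀ j, P j ≤ P i

/-- The best arm of `P` is unique. -/
def HasUniqueBest (P : Fin K → ℝ) : Prop := ∃! i, IsBest P i

/-- Kullback–Leibler divergence between unit-variance Gaussians with means `q` and `p`. -/
def gaussKL (q p : ℝ) : ℝ≥0∞ := ENNReal.ofReal ((q - p) ^ 2 / 2)

/-- The product `h * x` of a risk `h ∈ (0, ∞]` and an exponent `x ∈ [0, ∞]`, with `∞ * x = ∞` for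
every `x`, also for `x = 0`: an instance of infinite risk puts no constraint on a rate. -/
def riskMul (h x : ℝ≥0∞) : ℝ≥0∞ := if h = ⊤ then ⊤ else h * x

/-- An allocation function: it maps an empirical mean vector to sampling proportions. -/
abbrev Allocation (K : ℕ) : Type := (Fin K → ℝ) → stdSimplex ℝ (Fin K)

/-- Loss of the agent in the one-shot game, `H(P) ∑ᵢ wᵢ(Q) D(Qᵢ ‖ Pᵢ)`. -/
def loss (H : (Fin K → ℝ) → ℝ≥0∞) (w : Allocation K) (P Q : Fin K → ℝ) : ℝ≥0∞ :=
  riskMul (H P) (∑ i, ENNReal.ofReal ((w Q : Fin K → ℝ) i) * gaussKL (Q i) (P i))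

/-- Worst-case value of an allocation function: the infimum of the loss over true means `P` with a
unique best arm and empirical means `Q` of which this arm is not a maximiser. -/
def gameValue (H : (Fin K → ℝ) → ℝ≥0∞) (w : Allocation K) : ℝ≥0∞ :=
  ⨅ (P : Fin K → ℝ) (Q : Fin K → ℝ) (_ : HasUniqueBest P)
    (_ : ∀ i, IsBest P i → ¬ IsBest Q i), loss H w P Q

/-- The value of the one-shot game. -/
def Rgo (H : (Fin K → ℝ) → ℝ≥0∞) : ℝ≥0∞ :=
  ⨆ (w : Allocation K) (_ : Measurable w), gameValue H w

/-- A measurable allocation function attaining the value of the game. -/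
def IsOptimalAllocation (H : (Fin K → ℝ) → ℝ≥0∞) (w : Allocation K) : Prop :=
  Measurable w ∧ gameValue H w = Rgo H

/-! ### Algorithms and their rates -/

/-- A best arm identification algorithm for `K` arms, which may use the budget `T`. Rounds are
numbered from `0`. The arm sampled in round `t` is a function of the rewards of the rounds
`0, …, t - 1` (the arms sampled in those rounds are themselves functions of the earlier rewards),
and the recommended arm is a function of all `T` rewards. -/
structure Algorithm (K : ℕ) where
  sample : (T t : ℕ) → (Fin t → ℝ) → Fin K
  recommend : (T : ℕ) → (Fin T → ℝ) → Fin K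
  measurable_sample : ∀ T t, Measurable (sample T t)
  measurable_recommend : ∀ T, Measurable (recommend T)

/-- The law of a sequence of independent standard Gaussian noises, one for each round. -/
def noiseLaw : Measure (ℕ → ℝ) := Measure.infinitePi fun _ : ℕ => gaussianReal 0 1

/-- The reward of round `t` on the instance `P`: the mean of the sampled arm plus the noise. -/
def Algorithm.reward (A : Algorithm K) (T : ℕ) (P : Fin K → ℝ) (z : ℕ → ℝ) (t : ℕ) : ℝ :=
  P (A.sample T t fun s : Fin t => Algorithm.reward A T P z s) + z t
termination_by t
decreasing_by exact s.2

/-- Probability of error: the arm recommended after `T` rounds is not a best arm of `P`. -/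
def Algorithm.poe (A : Algorithm K) (P : Fin K → ℝ) (T : ℕ) : ℝ≥0∞ :=
  noiseLaw {z | ¬ IsBest P (A.recommend T fun t : Fin T => A.reward T P z t)}

/-- `liminf_{T → ∞} (1 / T) log (1 / PoE(P))`, which is `∞` if the error vanishes for large `T`. -/
def Algorithm.exponent (A : Algorithm K) (P : Fin K → ℝ) : ℝ≥0∞ :=
  liminf (fun T : ℕ => (ENNReal.log (A.poe P T)⁻¹).toENNReal / (T : ℝ≥0∞)) atTop

/-- The rate of an algorithm with respect to the risk measure `H`. -/
def Algorithm.rate (A : Algorithm K) (H : (Fin K → ℝ) → ℝ≥0∞) : ℝ≥0∞ :=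
  ⨅ (P : Fin K → ℝ) (_ : HasUniqueBest P), riskMul (H P) (A.exponent P)

/-! ### Pooled Allocation -/

open Classical in
/-- The arm of least index with the property `p`, or arm `0` if there is none. -/
def firstArm [NeZero K] (p : Fin K → Prop) : Fin K :=
  if h : (Finset.univ.filter p).Nonempty then (Finset.univ.filter p).min' h else 0

/-- The maximiser of `f` of least index. -/
def argmax [NeZero K] {α : Type*} [LE α] (f : Fin K → α) : Fin K :=
  firstArm fun i => ∀ j, f j ≤ f i

/-- Number of draws of arm `i` in a batch of `n` rounds with target proportions `v`: the number
`vᵢ n`, rounded in such a way that the numbers of draws are integers with sum at most `n`. -/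
def draws (n : ℕ) (v : stdSimplex ℝ (Fin K)) (i : Fin K) : ℕ :=
  ⌈(v : Fin K → ℝ) i * ((n - K : ℕ) : ℝ)⌉₊

/-- Within a batch the arms are drawn in increasing order; arm `i` is first drawn in the round of
the batch with this number (counted from `0`). -/
def offset (n : ℕ) (v : stdSimplex ℝ (Fin K)) (i : Fin K) : ℕ :=
  ∑ j ∈ Finset.Iio i, draws n v j

/-- Empirical mean of arm `i` in batch `b` (counted from `0`) with target proportions `v`, where `x`
is the sequence of rewards; batch `b` consists of the rounds `b * n, …, b * n + n - 1`. -/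
def batchMean (n : ℕ) (x : ℕ → ℝ) (b : ℕ) (v : stdSimplex ℝ (Fin K)) (i : Fin K) : ℝ :=
  (∑ s ∈ Finset.range (draws n v i), x (b * n + offset n v i + s)) / draws n v i

/-- The pooled means. Initially these are the means of the first `K` batches, batch `i` of which
draws arm `i` only; batch `K + m` has target proportions `w (pool m)` and gives `pool (m + 1)`. -/
def pool (w : Allocation K) (n : ℕ) (x : ℕ → ℝ) : ℕ → Fin K → ℝ
  | 0 => fun i => (∑ s ∈ Finset.range n, x (i * n + s)) / n
  | m + 1 => fun i =>
      (1 - (w (pool w n x m) : Fin K → ℝ) i) * pool w n x m i +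
        (w (pool w n x m) : Fin K → ℝ) i * batchMean n x (K + m) (w (pool w n x m)) i

/-- The arm drawn in round `t`, for batches of `n` rounds: arm `b` in batch `b < K`, and the blocks
of draws prescribed by the proportions `w (pool m)` in batch `K + m`. The rounds of a batch that
rounding leaves over go to arm `0`, and their rewards are not used. -/
def pooledSample [NeZero K] (w : Allocation K) (n t : ℕ) (x : ℕ → ℝ) : Fin K :=
  if h : t / n < K then ⟨t / n, h⟩
  else firstArm fun i =>
    t % n < offset n (w (pool w n x (t / n - K))) i + draws n (w (pool w n x (t / n - K))) i

/-- Number of victories of arm `i`: with `B` batches, `pool 0, …, pool (B - K - 1)` have a vote. -/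
def victories [NeZero K] (w : Allocation K) (B n : ℕ) (x : ℕ → ℝ) (i : Fin K) : ℕ :=
  ((Finset.range (B - K)).filter fun m => argmax (pool w n x m) = i).card

/-- Extension by zero of finitely many rewards. -/
def extend {t : ℕ} (x : Fin t → ℝ) (s : ℕ) : ℝ := if h : s < t then x ⟨s, h⟩ else 0

lemma measurable_extend (t : ℕ) : Measurable (extend : (Fin t → ℝ) → ℕ → ℝ) := by
  refine measurable_pi_lambda _ fun s => ?_
  unfold extend
  split_ifs with h
  · exact measurable_pi_apply _
  · exact measurable_const

lemma measurable_firstArm [NeZero K] {α : Type*} [MeasurableSpace α] {p : α → Fin K → Prop}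
    (hp : ∀ i, MeasurableSet {a | p a i}) : Measurable fun a => firstArm (p a) := by
  have h1 : Measurable (firstArm : (Fin K → Prop) → Fin K) := Measurable.of_discrete
  exact h1.comp (measurable_pi_lambda _ fun i => measurableSet_setOfPred.1 (hp i))

lemma measurable_natIndex {α β : Type*} [MeasurableSpace α] [MeasurableSpace β] {N : α → ℕ}
    (hN : Measurable N) {F : ℕ → α → β} (hF : ∀ k, Measurable (F k)) :
    Measurable fun a => F (N a) a := by
  have h : Measurable fun q : ℕ × α => F q.1 q.2 := measurable_from_prod_countable_right hF
  exact h.comp (hN.prodMk measurable_id)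

lemma measurable_simplexCoord (i : Fin K) :
    Measurable fun v : stdSimplex ℝ (Fin K) => (v : Fin K → ℝ) i :=
  (measurable_pi_apply i).comp measurable_subtype_coe

lemma measurable_draws (n : ℕ) (i : Fin K) :
    Measurable fun v : stdSimplex ℝ (Fin K) => draws n v i :=
  Nat.measurable_ceil.comp ((measurable_simplexCoord i).mul_const _)

lemma measurable_offset (n : ℕ) (i : Fin K) :
    Measurable fun v : stdSimplex ℝ (Fin K) => offset n v i :=
  Finset.measurable_sum _ fun j _ => measurable_draws n j

lemma measurable_batchMean {α : Type*} [MeasurableSpace α] (n b : ℕ) (i : Fin K)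
    {x : α → ℕ → ℝ} (hx : Measurable x) {v : α → stdSimplex ℝ (Fin K)} (hv : Measurable v) :
    Measurable fun a => batchMean n (x a) b (v a) i := by
  have hd : Measurable fun a => draws n (v a) i := (measurable_draws n i).comp hv
  have ho : Measurable fun a => offset n (v a) i := (measurable_offset n i).comp hv
  have hx' : ∀ k, Measurable fun a => x a k := fun k => (measurable_pi_apply k).comp hx
  refine Measurable.div ?_ ((measurable_from_top (f := (Nat.cast : ℕ → ℝ))).comp hd)
  refine measurable_natIndex
    (F := fun d a => ∑ s ∈ Finset.range d, x a (b * n + offset n (v a) i + s)) hd fun d => ?_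
  refine Finset.measurable_sum _ fun s _ => ?_
  exact measurable_natIndex (F := fun o a => x a (b * n + o + s)) ho fun o => hx' _

lemma measurable_pool {w : Allocation K} (hw : Measurable w) (n m : ℕ) :
    Measurable fun x : ℕ → ℝ => pool w n x m := by
  induction m with
  | zero =>
    refine measurable_pi_lambda _ fun i => ?_
    have h : Measurable fun x : ℕ → ℝ => ∑ s ∈ Finset.range n, x (i * n + s) :=
      Finset.measurable_sum _ fun s _ => measurable_pi_apply (i * n + s)
    simpa only [pool] using h.div_const _
  | succ m ih =>
    refine measurable_pi_lambda _ fun i => ?_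
    simp only [pool]
    have h1 : Measurable fun x : ℕ → ℝ => w (pool w n x m) := hw.comp ih
    have h2 : Measurable fun x : ℕ → ℝ => (w (pool w n x m) : Fin K → ℝ) i :=
      (measurable_simplexCoord i).comp h1
    have h3 : Measurable fun x : ℕ → ℝ => pool w n x m i := (measurable_pi_apply i).comp ih
    exact ((measurable_const.sub h2).mul h3).add
      (h2.mul (measurable_batchMean n (K + m) i measurable_id h1))

lemma measurable_argmax_pool [NeZero K] {w : Allocation K} (hw : Measurable w) (n m : ℕ) :
    Measurable fun x : ℕ → ℝ => argmax (pool w n x m) := by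
  refine measurable_firstArm fun i => ?_
  have h : ∀ j, Measurable fun x : ℕ → ℝ => pool w n x m j := fun j =>
    (measurable_pi_apply j).comp (measurable_pool hw n m)
  rw [Set.ofPred_forall]
  exact MeasurableSet.iInter fun j => measurableSet_le (h j) (h i)

lemma measurable_pooledSample [NeZero K] {w : Allocation K} (hw : Measurable w) (n t : ℕ) :
    Measurable fun x : ℕ → ℝ => pooledSample w n t x := by
  unfold pooledSample
  split_ifs with h
  · exact measurable_const
  · refine measurable_firstArm fun i => ?_
    have h1 : Measurable fun x : ℕ → ℝ => w (pool w n x (t / n - K)) :=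
      hw.comp (measurable_pool hw n _)
    exact measurableSet_lt measurable_const
      (((measurable_offset n i).comp h1).add ((measurable_draws n i).comp h1))

lemma measurable_victories [NeZero K] {w : Allocation K} (hw : Measurable w) (B n : ℕ)
    (i : Fin K) : Measurable fun x : ℕ → ℝ => victories w B n x i := by
  simp only [victories, Finset.card_filter]
  refine Finset.measurable_sum _ fun m _ => ?_
  exact Measurable.ite (measurable_argmax_pool hw n m (measurableSet_singleton i))
    measurable_const measurable_const

/-- Pooled Allocation with allocation function `w` and number of batches `B T` for the budget `T`.
Each batch has `T / B T` rounds (rounded down). The rewards of the fewer than `B T` rounds after the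
last batch are not used. The recommended arm is an arm with the largest number of victories. -/
def pooledAllocation [NeZero K] (w : Allocation K) (hw : Measurable w) (B : ℕ → ℕ) :
    Algorithm K where
  sample T t x := pooledSample w (T / B T) t (extend x)
  recommend T x := argmax (victories w (B T) (T / B T) (extend x))
  measurable_sample T t := (measurable_pooledSample hw _ t).comp (measurable_extend t)
  measurable_recommend T := by
    refine measurable_firstArm fun i => ?_
    have h : ∀ j, Measurable fun x : Fin T → ℝ => victories w (B T) (T / B T) (extend x) j :=
      fun j => (measurable_victories hw _ _ j).comp (measurable_extend T)
    rw [Set.ofPred_forall]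
    exact MeasurableSet.iInter fun j => measurableSet_le (h j) (h i)

/-- Admissible numbers of batches, `K = o(B)` and `K B = o(T)` as the budget `T` grows with the
number `K` of arms fixed. -/
def IsBatchSchedule (B : ℕ → ℕ) : Prop :=
  Tendsto B atTop atTop ∧
    (fun T : ℕ => (B T : ℝ)) =o[atTop] fun T : ℕ => (T : ℝ)

end BestArm

end

open BestArm

noncomputable section

namespace BestArm

variable {K : ℕ}

/-! ### Measurable selection of allocations -/

/-! Lower bound for Pooled Allocation. The argument is a potential estimate, pathwise in the noise.
Let `D` be the deviation of the pooled means from `P` and follow `(n - K) ∑ Dᵢ² / 2`. Updating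
replaces `Dᵢ` by `(1 - wᵢ) Dᵢ + wᵢ ξᵢ`, with `ξᵢ` the mean noise of the new draws. By convexity of
the square the potential drops by at least `(n - K) ∑ wᵢ Dᵢ² / 2`, up to the noise energy of the
batch, since arm `i` is drawn at least `wᵢ (n - K)` times. Telescoping, `(n - K)` times the sum of
the game costs `∑ wᵢ(Q) (Qᵢ - Pᵢ)² / 2` over all voting pools `Q` is at most the total energy
(`IsPooledRun.potential_le_energy`).

A wrong recommendation requires at least half of the votes to be wrong, and this is the origin of
the factor `1/2`. Almost surely there are no ties (`pool_ne_ae`), so a wrong vote is a move allowed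
in the game and costs at least any finite `c` below `gameValue H w / H P`. Hence an error forces an
energy of about `T c / 2`. The energy consists of `K (B - K + 1)` sequentially chosen terms, each
zero or half a squared standard Gaussian given the past. For `a < 1` its exponential moment is at
most `squareMoment a ^ (K (B - K + 1)) = exp (o(T))`, because `B = o(T)`. Chernoff's inequality and
`a → 1` give the exponent `c / 2`.

Upper bound. If an algorithm finds the unique best arm of `Q` with probability tending to one, then
for every `P` misled by `Q` its error under `P` is at least `exp (-T (∑ vᵢ (Qᵢ - Pᵢ)² / 2 + o(1)))`
along a subsequence of budgets, where `v` is a limit of the expected sampling proportions under `Q`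
(`Algorithm.transport`, `Algorithm.exists_exponent_le`). Since `v` does not depend on `P`, the agent
can play `v` at `Q` and secure the rate. Perturbation and compactness extend this to `Q` with ties,
and a measurable selection turns the pointwise choices into an allocation. Consistency of Pooled
Allocation is proved when the batches are long compared with their number, which is why the
algorithm of part (1) uses about `T^(1/4)` batches.

Existence of an optimal allocation uses the same selection: at each `Q` the worst-case loss is upper
semicontinuous in the proportions, so it has a maximiser on the compact simplex. -/

/-- The loss as a function of the sampling proportions and the two mean vectors. -/
def proportionLoss (H : (Fin K → ℝ) → ℝ≥0∞) (P Q : Fin K → ℝ) (v : stdSimplex ℝ (Fin K)) : ℝ≥0∞ :=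
  riskMul (H P) (∑ i, ENNReal.ofReal ((v : Fin K → ℝ) i) * gaussKL (Q i) (P i))

/-- The best arm of `P` is unique and it is not a best arm of `Q`. -/
def Misleads (P Q : Fin K → ℝ) : Prop := HasUniqueBest P ∧ ∀ i, IsBest P i → ¬ IsBest Q i

lemma le_gameValue_iff {H : (Fin K → ℝ) → ℝ≥0∞} {w : Allocation K} {r : ℝ≥0∞} :
    r ≤ gameValue H w ↔ ∀ P Q, Misleads P Q → r ≤ proportionLoss H P Q (w Q) := by
  simp only [gameValue, le_iInf_iff, Misleads, proportionLoss, loss, and_imp]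

lemma riskMul_mono {h x y : ℝ≥0∞} (hxy : x ≤ y) : riskMul h x ≤ riskMul h y := by
  unfold riskMul
  split_ifs
  · exact le_rfl
  · gcongr

/-- For `h = ⊤` the convention makes the map constant; the usual product `⊤ * x` would jump at `x =
0`. -/
lemma continuous_riskMul (h : ℝ≥0∞) : Continuous (riskMul h) := by
  unfold riskMul
  split_ifs with hh
  · exact continuous_const
  · exact ENNReal.continuous_const_mul hh

lemma continuous_proportionLoss (H : (Fin K → ℝ) → ℝ≥0∞) (P : Fin K → ℝ) :
    Continuous fun q : (Fin K → ℝ) × stdSimplex ℝ (Fin K) => proportionLoss H P q.1 q.2 := by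
  refine (continuous_riskMul _).comp (continuous_finsetSum _ fun i _ => ?_)
  have h : (fun q : (Fin K → ℝ) × stdSimplex ℝ (Fin K) =>
      ENNReal.ofReal ((q.2 : Fin K → ℝ) i) * gaussKL (q.1 i) (P i)) =
      fun q => ENNReal.ofReal ((q.2 : Fin K → ℝ) i * ((q.1 i - P i) ^ 2 / 2)) := by
    funext q
    exact (ENNReal.ofReal_mul (q.2.2.1 i)).symm
  rw [h]
  have h2 : Continuous fun q : (Fin K → ℝ) × stdSimplex ℝ (Fin K) => (q.2 : Fin K → ℝ) i :=
    (continuous_apply i).comp (continuous_subtype_val.comp continuous_snd)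
  have h1 : Continuous fun q : (Fin K → ℝ) × stdSimplex ℝ (Fin K) => q.1 i :=
    (continuous_apply i).comp continuous_fst
  exact ENNReal.continuous_ofReal.comp (h2.mul (((h1.sub continuous_const).pow 2).div_const 2))

/-- A nonempty compact metric space is a continuous image of the Cantor set. Parametrising by a
compact set of reals provides an order in which a least parameter can be selected. -/
lemma exists_continuous_surjection_of_compact_real (X : Type*) [Nonempty X] [MetricSpace X]
    [CompactSpace X] : ∃ (C : Set ℝ) (φ : C → X), IsCompact C ∧ Continuous φ ∧
      Function.Surjective φ := by
  obtain ⟨f, hf, hs⟩ := exists_nat_bool_continuous_surjective_of_compact X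
  refine ⟨cantorSet, f ∘ cantorSetHomeomorphNatToBool, isCompact_cantorSet,
    hf.comp (Homeomorph.continuous _), hs.comp (Homeomorph.surjective _)⟩

/-- A multifunction with closed graph and nonempty values in a compact metric space has a
measurable selection. -/
lemma exists_measurable_selection {Y X : Type*} [TopologicalSpace Y] [MeasurableSpace Y]
    [BorelSpace Y] [MetricSpace X] [CompactSpace X] [MeasurableSpace X] [BorelSpace X]
    {G : Set (Y × X)} (hG : IsClosed G) (hne : ∀ y, ∃ x, (y, x) ∈ G) :
    ∃ s : Y → X, Measurable s ∧ ∀ y, (y, s y) ∈ G := by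
  rcases isEmpty_or_nonempty X with hX | hX
  · have : IsEmpty Y := ⟨fun y => hX.elim (hne y).choose⟩
    exact ⟨fun y => isEmptyElim y, measurable_of_empty _, fun y => isEmptyElim y⟩
  obtain ⟨C, φ, hC, hφ, hsurj⟩ := exists_continuous_surjection_of_compact_real X
  have : CompactSpace C := isCompact_iff_compactSpace.1 hC
  -- The admissible parameters of `y` form a nonempty compact set of reals, so there is a least one;
  -- it defines the selection.
  have hmin : ∀ y, ∃ c : C, (y, φ c) ∈ G ∧ ∀ c' : C, (y, φ c') ∈ G → c ≤ c' := by
    intro y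
    have hcl : IsClosed {c : C | (y, φ c) ∈ G} := hG.preimage (by fun_prop)
    obtain ⟨x, hx⟩ := hne y
    obtain ⟨c0, rfl⟩ := hsurj x
    obtain ⟨c, hc, hc'⟩ := hcl.isCompact.exists_isMinOn ⟨c0, hx⟩ continuous_subtype_val.continuousOn
    exact ⟨c, hc, fun c' h => hc' h⟩
  choose c hc hcmin using hmin
  refine ⟨fun y => φ (c y), hφ.measurable.comp ?_, hc⟩
  refine Measurable.subtype_mk (f := fun y => (c y : ℝ)) (h := fun y => (c y).2)
    (measurable_of_Iic fun r => IsClosed.measurableSet ?_)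
  -- A sublevel set of the least parameter is the projection of a closed set along the compact
  -- factor `C`, hence closed.
  have : (fun y => (c y : ℝ)) ⁻¹' Set.Iic r =
      Prod.fst '' {q : Y × C | (q.1, φ q.2) ∈ G ∧ (q.2 : ℝ) ≤ r} := by
    ext y
    constructor
    · intro h
      exact ⟨(y, c y), ⟨hc y, h⟩, rfl⟩
    · rintro ⟨⟨y', c'⟩, ⟨h1, h2⟩, rfl⟩
      exact le_trans (Subtype.coe_le_coe.2 (hcmin y' c' h1)) h2
  rw [this]
  refine isClosedMap_fst_of_compactSpace _ (IsClosed.inter ?_ ?_)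
  · exact hG.preimage (f := fun q : Y × C => (q.1, φ q.2)) (by fun_prop)
  · exact isClosed_le (continuous_subtype_val.comp continuous_snd) continuous_const

lemma measurableSet_isBest_eq (S : Set (Fin K)) :
    MeasurableSet {Q : Fin K → ℝ | {i | IsBest Q i} = S} := by
  have h : ∀ i, MeasurableSet {Q : Fin K → ℝ | IsBest Q i} := by
    intro i
    have : {Q : Fin K → ℝ | IsBest Q i} = ⋂ j, {Q | Q j ≤ Q i} := by
      ext Q; simp [IsBest]
    rw [this]
    exact MeasurableSet.iInter fun j =>
      measurableSet_le (measurable_pi_apply j) (measurable_pi_apply i)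
  have : {Q : Fin K → ℝ | {i | IsBest Q i} = S} =
      ⋂ i, {Q | IsBest Q i ↔ i ∈ S} := by
    ext Q; simp [Set.ext_iff]
  rw [this]
  refine MeasurableSet.iInter fun i => ?_
  by_cases hi : i ∈ S
  · simpa [hi] using h i
  · simp only [hi, iff_false]
    exact (h i).compl

/-- Pointwise good proportions can be chosen measurably. -/
lemma exists_measurable_allocation [NeZero K] {H : (Fin K → ℝ) → ℝ≥0∞} {r : ℝ≥0∞}
    (h : ∀ Q : Fin K → ℝ, ∃ v, ∀ P, Misleads P Q → r ≤ proportionLoss H P Q v) :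
    ∃ w : Allocation K, Measurable w ∧ r ≤ gameValue H w := by
  -- The graph need not be closed on the whole space, because the set of best arms jumps. On the
  -- stratum of `Q` with best arms `S`, which `P` are misled depends only on `S`, so the graph is an
  -- intersection of closed conditions over a fixed family.
  have hS : ∀ S : Set (Fin K), ∃ s : {Q : Fin K → ℝ // {i | IsBest Q i} = S} →
      stdSimplex ℝ (Fin K), Measurable s ∧
        ∀ Q, (Q, s Q) ∈ {q : {Q : Fin K → ℝ // {i | IsBest Q i} = S} × stdSimplex ℝ (Fin K) |
          ∀ P, Misleads P q.1 → r ≤ proportionLoss H P q.1 q.2} := by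
    intro S
    refine exists_measurable_selection ?_ fun Q => h Q
    have : {q : {Q : Fin K → ℝ // {i | IsBest Q i} = S} × stdSimplex ℝ (Fin K) |
          ∀ P, Misleads P q.1 → r ≤ proportionLoss H P q.1 q.2} =
        ⋂ (P) (_ : HasUniqueBest P ∧ ∀ i, IsBest P i → i ∉ S),
          {q | r ≤ proportionLoss H P q.1 q.2} := by
      ext ⟨⟨Q, hQ⟩, v⟩
      subst hQ
      simp [Misleads]
    rw [this]
    refine isClosed_iInter fun P => isClosed_iInter fun _ => ?_
    have hc : Continuous fun q : {Q : Fin K → ℝ // {i | IsBest Q i} = S} × stdSimplex ℝ (Fin K) =>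
        ((q.1 : Fin K → ℝ), q.2) :=
      (continuous_subtype_val.comp continuous_fst).prodMk continuous_snd
    exact isClosed_Ici.preimage ((continuous_proportionLoss H P).comp hc)
  choose s hs hsel using hS
  have hpre : ∀ A, (fun Q => s {i | IsBest Q i} ⟨Q, rfl⟩) ⁻¹' A =
      ⋃ S, Subtype.val '' (s S ⁻¹' A) := by
    intro A
    ext Q
    simp
  refine ⟨fun Q => s {i | IsBest Q i} ⟨Q, rfl⟩, fun A hA => ?_, le_gameValue_iff.2 fun P Q hPQ =>
    hsel {i | IsBest Q i} ⟨Q, rfl⟩ P hPQ⟩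
  rw [hpre]
  exact MeasurableSet.iUnion fun S => 
    (MeasurableEmbedding.subtype_coe (measurableSet_isBest_eq S)).measurableSet_image.2 (hs S hA)

/-- Every mean vector has proportions which attain the value of the game. -/
lemma exists_proportions_ge_Rgo [NeZero K] (H : (Fin K → ℝ) → ℝ≥0∞) (Q : Fin K → ℝ) :
    ∃ v, ∀ P, Misleads P Q → Rgo H ≤ proportionLoss H P Q v := by
  -- An infimum of continuous functions is upper semicontinuous and attains its maximum on the
  -- simplex; the maximiser does at least as well at `Q` as the value `w Q` of any allocation.
  have hus : UpperSemicontinuousOn (fun v => ⨅ (P) (_ : Misleads P Q), proportionLoss H P Q v)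
      Set.univ := by
    refine UpperSemicontinuous.upperSemicontinuousOn ?_ _
    refine upperSemicontinuous_iInf fun P => upperSemicontinuous_iInf fun _ => ?_
    exact ((continuous_proportionLoss H P).comp
      (continuous_const.prodMk continuous_id)).upperSemicontinuous
  obtain ⟨v, -, hv⟩ := hus.exists_isMaxOn Set.univ_nonempty isCompact_univ
  refine ⟨v, fun P hP => iSup₂_le fun w _ => ?_⟩
  refine (le_trans ?_ (hv (Set.mem_univ (w Q)))).trans (iInf₂_le P hP)
  exact le_iInf₂ fun P' hP' => le_gameValue_iff.1 le_rfl P' Q hP'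

lemma gameValue_le_Rgo {H : (Fin K → ℝ) → ℝ≥0∞} {w : Allocation K} (hw : Measurable w) :
    gameValue H w ≤ Rgo H := le_iSup₂ (f := fun w (_ : Measurable w) => gameValue H w) w hw

lemma exists_isOptimalAllocation [NeZero K] (H : (Fin K → ℝ) → ℝ≥0∞) :
    ∃ w, IsOptimalAllocation H w := by
  obtain ⟨w, hw, hr⟩ := exists_measurable_allocation (exists_proportions_ge_Rgo H)
  exact ⟨w, hw, le_antisymm (gameValue_le_Rgo hw) hr⟩

/-- This is how a bound on rates reaches the game: proportions found separately for each `Q` can be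
glued into one measurable allocation. -/
lemma le_Rgo_of_forall_exists [NeZero K] {H : (Fin K → ℝ) → ℝ≥0∞} {r : ℝ≥0∞}
    (h : ∀ Q : Fin K → ℝ, ∃ v, ∀ P, Misleads P Q → r ≤ proportionLoss H P Q v) :
    r ≤ Rgo H := by
  obtain ⟨w, hw, hr⟩ := exists_measurable_allocation h
  exact hr.trans (gameValue_le_Rgo hw)

lemma isBest_pi_update_of_isBest {Q : Fin K → ℝ} {j : Fin K} (hj : IsBest Q j) {ε : ℝ}
    (hε : 0 < ε) (i : Fin K) : IsBest (Function.update Q j (Q j + ε)) i ↔ i = j := by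
  constructor
  · intro h
    by_contra hij
    have := h j
    rw [Function.update_self, Function.update_of_ne hij] at this
    linarith [hj i]
  · rintro rfl k
    by_cases hk : k = i
    · rw [hk]
    · rw [Function.update_self, Function.update_of_ne hk]
      linarith [hj k]

/-- It suffices to find good proportions for the mean vectors with a unique best arm. -/
lemma exists_proportions_of_unique [NeZero K] {H : (Fin K → ℝ) → ℝ≥0∞} {r : ℝ≥0∞}
    (h : ∀ Q : Fin K → ℝ, HasUniqueBest Q →
      ∃ v, ∀ P, Misleads P Q → r ≤ proportionLoss H P Q v) (Q : Fin K → ℝ) :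
    ∃ v, ∀ P, Misleads P Q → r ≤ proportionLoss H P Q v := by
  obtain ⟨j, hj⟩ : ∃ j, IsBest Q j := Finite.exists_max Q
  have hε : ∀ k : ℕ, (0 : ℝ) < 1 / ((k : ℝ) + 1) := fun k => Nat.one_div_pos_of_nat
  -- Raising one best arm `j` slightly makes it the unique best arm. Every `P` misled by `Q` is
  -- misled by the perturbation, since `j` is not its best arm; a limit point of the proportions
  -- then works at `Q`.
  set Q' : ℕ → Fin K → ℝ := fun k => Function.update Q j (Q j + 1 / ((k : ℝ) + 1)) with hQ'
  have hbest : ∀ k i, IsBest (Q' k) i ↔ i = j := fun k i => isBest_pi_update_of_isBest hj (hε k) i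
  have hv : ∀ k, ∃ v, ∀ P, Misleads P (Q' k) → r ≤ proportionLoss H P (Q' k) v := fun k =>
    h _ ⟨j, (hbest k j).2 rfl, fun i hi => (hbest k i).1 hi⟩
  choose v hv using hv
  obtain ⟨a, -, ψ, hψ, hlim⟩ := isCompact_univ.tendsto_subseq fun k => Set.mem_univ (v k)
  have hQlim : Tendsto Q' atTop (nhds Q) := by
    have h1 : Tendsto (fun k : ℕ => Q j + 1 / ((k : ℝ) + 1)) atTop (nhds (Q j)) := by
      simpa using tendsto_one_div_add_atTop_nhds_zero_nat.const_add (Q j)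
    simpa [hQ'] using (tendsto_const_nhds (x := Q)).update j h1
  refine ⟨a, fun P hP => ?_⟩
  refine ge_of_tendsto' (((continuous_proportionLoss H P).tendsto (Q, a)).comp
    ((hQlim.comp hψ.tendsto_atTop).prodMk_nhds hlim)) fun k => ?_
  refine hv _ P ⟨hP.1, fun i hi hi' => hP.2 i hi ?_⟩
  rw [(hbest _ i).1 hi']
  exact hj

/-! ### The noise sequence -/

instance : IsProbabilityMeasure noiseLaw := by
  unfold noiseLaw; infer_instance

lemma iIndepFun_noise : iIndepFun (fun (k : ℕ) (z : ℕ → ℝ) => z k) noiseLaw :=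
  iIndepFun_infinitePi (P := fun _ : ℕ => gaussianReal 0 1) (X := fun _ x => x)
    fun _ => measurable_id

lemma map_eval_noiseLaw (k : ℕ) : noiseLaw.map (fun z => z k) = gaussianReal 0 1 :=
  Measure.infinitePi_map_eval (fun _ : ℕ => gaussianReal 0 1) k

/-- `f` depends only on the coordinates in `S`. -/
def DependsOnlyOn {β : Type*} (f : (ℕ → ℝ) → β) (S : Set ℕ) : Prop :=
  ∀ z z' : ℕ → ℝ, (∀ k ∈ S, z k = z' k) → f z = f z'

/-- Independence of the coordinates of the noise in two disjoint finite sets. -/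
lemma lintegral_noise_diag {S T : Finset ℕ} (hST : Disjoint S T)
    {f : (ℕ → ℝ) → (ℕ → ℝ) → ℝ≥0∞} (hf : Measurable (Function.uncurry f))
    (h1 : ∀ y, DependsOnlyOn (fun z => f z y) S) (h2 : ∀ z, DependsOnlyOn (f z) T) :
    ∫⁻ z, f z z ∂noiseLaw = ∫⁻ z, ∫⁻ y, f z y ∂noiseLaw ∂noiseLaw := by
  -- Restricting to `U` and extending by zero preserves the coordinates in `U`, so `f` factors
  -- through two independent finite vectors.
  let e : (U : Finset ℕ) → (U → ℝ) → ℕ → ℝ := fun U a k => if h : k ∈ U then a ⟨k, h⟩ else 0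
  let ρ : (U : Finset ℕ) → (ℕ → ℝ) → U → ℝ := fun U z k => z k
  have he : ∀ U, Measurable (e U) := by
    intro U
    refine measurable_pi_lambda _ fun k => ?_
    by_cases h : k ∈ U
    · simpa [e, h] using measurable_pi_apply _
    · simp [e, h]
  have hρ : ∀ U, Measurable (ρ U) := fun U => measurable_pi_lambda _ fun k => measurable_pi_apply _
  have heρ : ∀ U z k, k ∈ U → e U (ρ U z) k = z k := by
    intro U z k hk
    simp [e, ρ, hk]
  let g : (S → ℝ) × (T → ℝ) → ℝ≥0∞ := fun q => f (e S q.1) (e T q.2)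
  have hg : Measurable g :=
    hf.comp (((he S).comp measurable_fst).prodMk ((he T).comp measurable_snd))
  have hfg : ∀ z y, f z y = g (ρ S z, ρ T y) := by
    intro z y
    exact (h1 y z _ fun k hk => (heρ S z k hk).symm).trans
      (h2 _ y _ fun k hk => (heρ T y k hk).symm)
  have hind : IndepFun (ρ S) (ρ T) noiseLaw :=
    iIndepFun_noise.indepFun_finset S T hST fun k => measurable_pi_apply k
  have hmap := (indepFun_iff_map_prod_eq_prod_map_map (hρ S).aemeasurable
    (hρ T).aemeasurable).1 hind
  simp_rw [hfg]
  rw [← lintegral_map hg ((hρ S).prodMk (hρ T)), hmap, lintegral_prod _ hg.aemeasurable,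
    lintegral_map (hg.lintegral_prod_right') (hρ S)]
  refine lintegral_congr fun z => ?_
  exact lintegral_map (f := fun y => g (ρ S z, y)) (hg.comp measurable_prodMk_left) (hρ T)

lemma lintegral_noise_mul {S T : Finset ℕ} (hST : Disjoint S T) {f g : (ℕ → ℝ) → ℝ≥0∞}
    (hf : Measurable f) (hg : Measurable g) (hfS : DependsOnlyOn f S) (hgT : DependsOnlyOn g T) :
    ∫⁻ z, f z * g z ∂noiseLaw = (∫⁻ z, f z ∂noiseLaw) * ∫⁻ z, g z ∂noiseLaw := by
  rw [lintegral_noise_diag (f := fun z y => f z * g y) hST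
    ((hf.comp measurable_fst).mul (hg.comp measurable_snd))
    (fun y z z' h => by simp only [hfS z z' h]) (fun z y y' h => by simp only [hgT y y' h])]
  simp_rw [lintegral_const_mul _ hg]
  rw [lintegral_mul_const _ hf]

lemma lintegral_noise_prod {ι : Type*} (s : Finset ι) {S : ι → Finset ℕ}
    (hS : (s : Set ι).PairwiseDisjoint S) {f : ι → (ℕ → ℝ) → ℝ≥0∞} (hf : ∀ i, Measurable (f i))
    (hfS : ∀ i, DependsOnlyOn (f i) (S i)) :
    ∫⁻ z, ∏ i ∈ s, f i z ∂noiseLaw = ∏ i ∈ s, ∫⁻ z, f i z ∂noiseLaw := by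
  classical
  induction s using Finset.induction_on with
  | empty => simp
  | insert a s ha ih =>
    simp_rw [Finset.prod_insert ha]
    rw [← ih (hS.subset (by simp))]
    refine lintegral_noise_mul (S := S a) (T := s.biUnion S) ?_ (hf a)
      (Finset.measurable_prod _ fun i _ => hf i) (hfS a) ?_
    · rw [Finset.disjoint_biUnion_right]
      intro i hi
      exact hS (by simp) (by simp [hi]) (by rintro rfl; exact ha hi)
    · intro z z' h
      refine Finset.prod_congr rfl fun i hi => hfS i z z' fun k hk => h k ?_
      simp only [Finset.coe_biUnion, Set.mem_iUnion]
      exact ⟨i, hi, hk⟩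

/-- A finite linear combination of the noises is Gaussian. -/
lemma map_sum_mul_noise (c : ℕ → ℝ) (s : Finset ℕ) :
    noiseLaw.map (fun z => ∑ k ∈ s, c k * z k) =
      gaussianReal 0 (∑ k ∈ s, c k ^ 2).toNNReal := by
  induction s using Finset.induction_on with
  | empty => simp [Measure.map_const]
  | insert a s ha ih =>
    have h1 : noiseLaw.map (fun z => c a * z a) = gaussianReal 0 (c a ^ 2).toNNReal := by
      have := gaussianReal_map_const_mul (μ := 0) (v := 1) (c a)
      rw [← map_eval_noiseLaw a, Measure.map_map (g := fun x : ℝ => c a * x)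
        (measurable_const_mul _) (measurable_pi_apply a)] at this
      rw [Real.toNNReal_of_nonneg (sq_nonneg (c a))]
      simpa [Function.comp_def, map_eval_noiseLaw] using this
    have hind : IndepFun (fun z : ℕ → ℝ => c a * z a) (fun z => ∑ k ∈ s, c k * z k) noiseLaw := by
      have := iIndepFun_noise.indepFun_finset {a} s (by simpa using ha)
        fun k => measurable_pi_apply k
      have h3 := this.comp (φ := fun x : ({a} : Finset ℕ) → ℝ => c a * x ⟨a, by simp⟩)
        (ψ := fun y : s → ℝ => ∑ k : s, c k * y k)
        (by fun_prop)
        (Finset.measurable_sum _ fun k _ => (measurable_pi_apply k).const_mul _)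
      convert h3 using 1
      · rfl
      · exact funext fun z => (Finset.sum_coe_sort s fun k => c k * z k).symm
    have := gaussianReal_add_gaussianReal_of_indepFun (P := noiseLaw) hind h1 ih
    simp_rw [Finset.sum_insert ha]
    rw [Real.toNNReal_add (sq_nonneg _) (Finset.sum_nonneg fun k _ => sq_nonneg (c k))]
    simpa [Pi.add_def] using this

/-- One nonzero coefficient makes the variance positive, and a nondegenerate Gaussian has no atoms.
-/
lemma noise_sum_ne_ae {c : ℕ → ℝ} {s : Finset ℕ} {k : ℕ} (hk : k ∈ s) (hc : c k ≠ 0) (r : ℝ) :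
    ∀ᵐ z ∂noiseLaw, ∑ k ∈ s, c k * z k ≠ r := by
  have hm : Measurable fun z : ℕ → ℝ => ∑ k ∈ s, c k * z k :=
    Finset.measurable_sum _ fun k _ => (measurable_pi_apply k).const_mul _
  have hv : (∑ k ∈ s, c k ^ 2).toNNReal ≠ 0 := by
    rw [Ne, Real.toNNReal_eq_zero, not_le]
    exact Finset.sum_pos' (fun k _ => sq_nonneg (c k)) ⟨k, hk, by positivity⟩
  have : NullSingletonClass (noiseLaw.map fun z => ∑ k ∈ s, c k * z k) := by
    rw [map_sum_mul_noise]
    exact nullSingletonClass_gaussianReal hv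
  have h0 : (noiseLaw.map fun z => ∑ k ∈ s, c k * z k) {r} = 0 := measure_singleton r
  rw [Measure.map_apply hm (measurableSet_singleton r)] at h0
  exact measure_eq_zero_iff_ae_notMem.1 h0

/-- The exponential moment of order `a` of half the square of a standard Gaussian. -/
def squareMoment (a : ℝ) : ℝ≥0∞ := ∫⁻ x, ENNReal.ofReal (Real.exp (a * (x ^ 2 / 2))) ∂gaussianReal 0 1

/-- Against the Gaussian density the integrand becomes a multiple of `exp (-(1 - a) x² / 2)`. This
is the source of the restriction `a < 1`. -/
lemma squareMoment_lt_top {a : ℝ} (ha : a < 1) : squareMoment a < ⊤ := by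
  unfold squareMoment
  rw [gaussianReal_of_var_ne_zero _ one_ne_zero, lintegral_withDensity_eq_lintegral_mul _
    (measurable_gaussianPDF _ _) (by fun_prop)]
  have h : Integrable fun x : ℝ => (√(2 * Real.pi))⁻¹ * Real.exp (-((1 - a) / 2) * x ^ 2) :=
    (integrable_exp_neg_mul_sq (by linarith)).const_mul _
  refine lt_of_eq_of_lt (lintegral_congr fun x => ?_) h.lintegral_lt_top
  rw [Pi.mul_apply, gaussianPDF, ← ENNReal.ofReal_mul (gaussianPDFReal_nonneg _ _ _),
    gaussianPDFReal, mul_assoc, ← Real.exp_add]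
  congr 2
  · simp
  · congr 1
    simp
    ring

lemma one_le_squareMoment {a : ℝ} (ha : 0 ≤ a) : 1 ≤ squareMoment a := by
  calc (1 : ℝ≥0∞) = ∫⁻ _, 1 ∂gaussianReal 0 1 := by simp
    _ ≤ squareMoment a := lintegral_mono fun x => by
        simp only [ENNReal.one_le_ofReal, Real.one_le_exp_iff]
        positivity

/-- The mean of `d` noises times `√d` is standard Gaussian, so the exponent is `a` times half its
square. -/
lemma lintegral_exp_block_le {a : ℝ} (ha : 0 ≤ a) (o d : ℕ) :
    ∫⁻ z, ENNReal.ofReal (Real.exp (a * (d * ((∑ s ∈ Finset.range d, z (o + s)) / d) ^ 2 / 2)))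
      ∂noiseLaw ≤ squareMoment a := by
  -- An empty block has mean `0 / 0 = 0`, so the integral is `1`; this is where `0 ≤ a` matters.
  rcases Nat.eq_zero_or_pos d with rfl | hd
  · simpa using one_le_squareMoment ha
  have hd' : (0 : ℝ) < d := by exact_mod_cast hd
  have hlaw : noiseLaw.map (fun z => ∑ k ∈ Finset.Ico o (o + d), (√d)⁻¹ * z k) =
      gaussianReal 0 1 := by
    rw [map_sum_mul_noise]
    congr 1
    simp [hd'.ne', Real.sq_sqrt]
  rw [squareMoment, ← hlaw, lintegral_map (by fun_prop) (by fun_prop)]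
  refine le_of_eq (lintegral_congr fun z => ?_)
  rw [← Finset.mul_sum, Finset.sum_Ico_eq_sum_range, Nat.add_sub_cancel_left, mul_pow, inv_pow,
    Real.sq_sqrt hd'.le]
  congr 3
  field_simp

lemma lintegral_exp_blocks_le {a : ℝ} (ha : 0 ≤ a) (o d : Fin K → ℕ)
    (hod : ∀ i j, i < j → o i + d i ≤ o j) :
    ∫⁻ z, ENNReal.ofReal (Real.exp (a * ∑ i,
      d i * ((∑ s ∈ Finset.range (d i), z (o i + s)) / d i) ^ 2 / 2)) ∂noiseLaw ≤
        squareMoment a ^ K := by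
  simp_rw [Finset.mul_sum, Real.exp_sum, ENNReal.ofReal_prod_of_nonneg fun _ _ => (Real.exp_pos _).le]
  rw [lintegral_noise_prod (S := fun i => Finset.Ico (o i) (o i + d i))]
  · calc _ ≤ ∏ _i : Fin K, squareMoment a :=
        Finset.prod_le_prod' fun i _ => lintegral_exp_block_le ha _ _
      _ = _ := by simp
  · intro i _ j _ hij
    rw [Function.onFun, Finset.disjoint_left]
    intro x hx hx'
    rw [Finset.mem_Ico] at hx hx'
    rcases lt_or_gt_of_ne hij with h | h
    · have := hod i j h; omega
    · have := hod j i h; omega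
  · intro i
    fun_prop
  · intro i z z' h
    have : ∑ s ∈ Finset.range (d i), z (o i + s) = ∑ s ∈ Finset.range (d i), z' (o i + s) := by
      refine Finset.sum_congr rfl fun s hs => h _ ?_
      have := Finset.mem_range.1 hs
      simp [this]
    simp only [this]

/-- One-dimensional change of measure. -/
lemma lintegral_gaussian_shift {g : ℝ → ℝ≥0∞} (hg : Measurable g) (p q : ℝ) :
    ∫⁻ x, g (p + x) ∂gaussianReal 0 1 =
      ∫⁻ x, g (q + x) * ENNReal.ofReal (Real.exp (-((q - p) * x + (q - p) ^ 2 / 2)))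
        ∂gaussianReal 0 1 := by
  rw [gaussianReal_of_var_ne_zero _ one_ne_zero, lintegral_withDensity_eq_lintegral_mul _
    (measurable_gaussianPDF _ _) (by fun_prop), lintegral_withDensity_eq_lintegral_mul _
    (measurable_gaussianPDF _ _) (by fun_prop),
    ← lintegral_add_right_eq_self _ (q - p)]
  refine lintegral_congr fun x => ?_
  simp only [Pi.mul_apply, gaussianPDF]
  rw [mul_comm (g _), ← mul_assoc, ← ENNReal.ofReal_mul (gaussianPDFReal_nonneg _ _ _)]
  congr 2
  · rw [gaussianPDFReal, gaussianPDFReal, mul_assoc (√_)⁻¹, ← Real.exp_add]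
    congr 2
    simp
    ring
  · ring_nf

/-! ### Runs of an algorithm -/

lemma Algorithm.reward_eq (A : Algorithm K) (T : ℕ) (P : Fin K → ℝ) (z : ℕ → ℝ) (t : ℕ) :
    A.reward T P z t = P (A.sample T t fun s : Fin t => A.reward T P z s) + z t := by
  rw [Algorithm.reward]

lemma Algorithm.reward_dependsOnlyOn (A : Algorithm K) (T : ℕ) (P : Fin K → ℝ) (t : ℕ) :
    DependsOnlyOn (fun z => A.reward T P z t) (Set.Iic t) := by
  induction t using Nat.strong_induction_on with
  | _ t ih =>
    intro z z' h
    simp only [A.reward_eq T P _ t]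
    rw [h t (by simp)]
    congr 3
    funext s
    exact ih s s.2 z z' fun k hk => h k ((Set.mem_Iic.1 hk).trans s.2.le)

lemma Algorithm.measurable_reward (A : Algorithm K) (T : ℕ) (P : Fin K → ℝ) (t : ℕ) :
    Measurable fun z => A.reward T P z t := by
  induction t using Nat.strong_induction_on with
  | _ t ih =>
    simp only [A.reward_eq T P _ t]
    exact ((Measurable.of_discrete (f := P)).comp ((A.measurable_sample T t).comp
      (measurable_pi_lambda _ fun s => ih s s.2))).add (measurable_pi_apply t)

lemma Algorithm.measurable_reward_seq (A : Algorithm K) (T : ℕ) (P : Fin K → ℝ) :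
    Measurable fun z => A.reward T P z := measurable_pi_lambda _ fun t => A.measurable_reward T P t

/-! ### Deterministic analysis of Pooled Allocation -/

lemma le_draws (n : ℕ) (v : stdSimplex ℝ (Fin K)) (i : Fin K) :
    (v : Fin K → ℝ) i * ((n - K : ℕ) : ℝ) ≤ draws n v i := Nat.le_ceil _

/-- Rounding up adds at most one draw per arm, which the `K` rounds withheld in `n - K` pay for. -/
lemma sum_draws_le {n : ℕ} (hn : K ≤ n) (v : stdSimplex ℝ (Fin K)) : ∑ i, draws n v i ≤ n := by
  have h : ∀ i, (draws n v i : ℝ) ≤ (v : Fin K → ℝ) i * ((n - K : ℕ) : ℝ) + 1 := fun i =>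
    (Nat.ceil_lt_add_one (mul_nonneg (v.2.1 i) (Nat.cast_nonneg _))).le
  have h2 : ((∑ i, draws n v i : ℕ) : ℝ) ≤ n := by
    push_cast
    calc ∑ i, (draws n v i : ℝ) ≤ ∑ i, ((v : Fin K → ℝ) i * ((n - K : ℕ) : ℝ) + 1) :=
          Finset.sum_le_sum fun i _ => h i
      _ = (∑ i, (v : Fin K → ℝ) i) * ((n - K : ℕ) : ℝ) + K := by
          rw [Finset.sum_add_distrib, Finset.sum_mul]; simp
      _ = n := by
          have : ∑ i, (v : Fin K → ℝ) i = 1 := v.2.2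
          rw [this, Nat.cast_sub hn]; ring
  exact_mod_cast h2

lemma offset_add_draws (n : ℕ) (v : stdSimplex ℝ (Fin K)) (i : Fin K) :
    offset n v i + draws n v i = ∑ j ∈ Finset.Iic i, draws n v j := by
  rw [offset, ← Finset.Iio_insert i, Finset.sum_insert (by simp), add_comm]

lemma offset_add_draws_le_offset (n : ℕ) (v : stdSimplex ℝ (Fin K)) {i j : Fin K} (hij : i < j) :
    offset n v i + draws n v i ≤ offset n v j := by
  rw [offset_add_draws]
  exact Finset.sum_le_sum_of_subset fun k hk => by
    rw [Finset.mem_Iio]; exact (Finset.mem_Iic.1 hk).trans_lt hij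

lemma offset_add_draws_le {n : ℕ} (hn : K ≤ n) (v : stdSimplex ℝ (Fin K)) (i : Fin K) :
    offset n v i + draws n v i ≤ n := by
  rw [offset_add_draws]
  exact (Finset.sum_le_sum_of_subset (Finset.subset_univ _)).trans (sum_draws_le hn v)

lemma batchMean_congr {n : ℕ} (hn : K ≤ n) {b : ℕ} {x y : ℕ → ℝ}
    (h : ∀ k, b * n ≤ k → k < (b + 1) * n → x k = y k) (v : stdSimplex ℝ (Fin K)) (i : Fin K) :
    batchMean n x b v i = batchMean n y b v i := by
  unfold batchMean
  congr 1
  refine Finset.sum_congr rfl fun s hs => h _ (by omega) ?_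
  have := offset_add_draws_le hn v i
  have := Finset.mem_range.1 hs
  rw [add_mul]
  omega

lemma pool_dependsOnlyOn {n : ℕ} (hn : K ≤ n) (w : Allocation K) (m : ℕ) :
    DependsOnlyOn (fun x => pool w n x m) (Set.Iio ((K + m) * n)) := by
  induction m with
  | zero =>
    intro x y h
    funext i
    simp only [pool]
    congr 1
    refine Finset.sum_congr rfl fun s hs => h _ ?_
    have h1 := Finset.mem_range.1 hs
    have h2 : ((i : ℕ) + 1) * n ≤ K * n := Nat.mul_le_mul_right n i.2
    rw [add_mul] at h2
    rw [add_zero, Set.mem_Iio]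
    omega
  | succ m ih =>
    intro x y h
    have h0 : pool w n x m = pool w n y m := ih x y fun k hk => h k
      (Set.mem_Iio.2 (lt_of_lt_of_le (Set.mem_Iio.1 hk) (Nat.mul_le_mul_right n (by omega))))
    funext i
    simp only [pool]
    rw [h0, batchMean_congr (b := K + m) (y := y) hn fun k _ hk => h k (Set.mem_Iio.2 hk)]

lemma firstArm_eq [NeZero K] {p : Fin K → Prop} {i : Fin K} (hi : p i) (h : ∀ j < i, ¬ p j) :
    firstArm p = i := by
  classical
  have hne : (Finset.univ.filter p).Nonempty := ⟨i, by simpa using hi⟩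
  have : firstArm p = (Finset.univ.filter p).min' hne := by
    unfold firstArm
    rw [dif_pos (by convert hne)]
  rw [this]
  refine le_antisymm (Finset.min'_le _ _ (by simpa using hi)) ?_
  refine Finset.le_min' _ _ _ fun j hj => ?_
  by_contra hji
  exact h j (not_le.1 hji) (by simpa using hj)

lemma firstArm_spec [NeZero K] {p : Fin K → Prop} (h : ∃ i, p i) : p (firstArm p) := by
  classical
  obtain ⟨i, hi⟩ := h
  have hne : (Finset.univ.filter p).Nonempty := ⟨i, by simpa using hi⟩
  have : firstArm p = (Finset.univ.filter p).min' hne := by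
    unfold firstArm
    rw [dif_pos (by convert hne)]
  rw [this]
  simpa using Finset.min'_mem _ hne

lemma argmax_spec [NeZero K] {α : Type*} [LinearOrder α] (f : Fin K → α) (j : Fin K) :
    f j ≤ f (argmax f) := firstArm_spec (p := fun i => ∀ j, f j ≤ f i) (Finite.exists_max f) j

/-- Round `t` lies in batch `t / n`, whose proportions use only earlier batches, that is `(t / n) *
n ≤ t` rewards. Hence the algorithm, which sees the past extended by zero, plays as if it knew the
whole sequence. -/
lemma pooledSample_dependsOnlyOn [NeZero K] {n : ℕ} (hn : K ≤ n) (w : Allocation K) (t : ℕ) :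
    DependsOnlyOn (pooledSample w n t) (Set.Iio t) := by
  intro x y h
  unfold pooledSample
  split_ifs with ht
  · rfl
  · have : pool w n x (t / n - K) = pool w n y (t / n - K) := by
      refine pool_dependsOnlyOn hn w _ x y fun k hk => h k (Set.mem_Iio.2 (lt_of_lt_of_le (Set.mem_Iio.1 hk) ?_))
      rw [Nat.add_sub_cancel' (not_lt.1 ht)]
      exact Nat.div_mul_le_self t n
    rw [this]

/-- `x` is the sequence of rewards of Pooled Allocation with batches of `n` rounds on the instance
`P`, and `z` is the sequence of noises. -/
def IsPooledRun [NeZero K] (P : Fin K → ℝ) (w : Allocation K) (n : ℕ) (x z : ℕ → ℝ) : Prop :=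
  ∀ t, x t = P (pooledSample w n t x) + z t

lemma isPooledRun_reward [NeZero K] (w : Allocation K) (hw : Measurable w) (B : ℕ → ℕ) (T : ℕ)
    (P : Fin K → ℝ) (z : ℕ → ℝ) (hn : K ≤ T / B T) :
    IsPooledRun P w (T / B T) ((pooledAllocation w hw B).reward T P z) z := by
  intro t
  rw [Algorithm.reward_eq]
  congr 2
  refine pooledSample_dependsOnlyOn hn w t _ _ fun k hk => ?_
  rw [extend, dif_pos (Set.mem_Iio.1 hk)]

namespace IsPooledRun

variable [NeZero K] {P : Fin K → ℝ} {w : Allocation K} {n : ℕ} {x z : ℕ → ℝ}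

lemma pool_zero (h : IsPooledRun P w n x z) (hn : 0 < n) (i : Fin K) :
    pool w n x 0 i = P i + (∑ s ∈ Finset.range n, z (i * n + s)) / n := by
  have hx : ∀ s ∈ Finset.range n, x (i * n + s) = P i + z (i * n + s) := by
    intro s hs
    have hdiv : (i * n + s) / n = (i : ℕ) := by
      rw [mul_comm, Nat.mul_add_div hn, Nat.div_eq_of_lt (Finset.mem_range.1 hs), add_zero]
    have hsample : pooledSample w n (i * n + s) x = i := by
      unfold pooledSample
      rw [dif_pos (by rw [hdiv]; exact i.2)]
      exact Fin.ext hdiv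
    rw [h, hsample]
  have hn' : (n : ℝ) ≠ 0 := by exact_mod_cast hn.ne'
  simp only [pool]
  rw [Finset.sum_congr rfl hx, Finset.sum_add_distrib]
  simp
  field_simp

lemma batchMean_eq (h : IsPooledRun P w n x z) (hn : K ≤ n) (m : ℕ) (i : Fin K)
    (hd : 0 < draws n (w (pool w n x m)) i) :
    batchMean n x (K + m) (w (pool w n x m)) i =
      P i + batchMean n z (K + m) (w (pool w n x m)) i := by
  set v := w (pool w n x m) with hv
  have hle := offset_add_draws_le hn v i
  have hx : ∀ s ∈ Finset.range (draws n v i), x ((K + m) * n + offset n v i + s) =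
      P i + z ((K + m) * n + offset n v i + s) := by
    intro s hs
    have hs' := Finset.mem_range.1 hs
    have hlt : offset n v i + s < n := by omega
    have hdiv : ((K + m) * n + offset n v i + s) / n = K + m := by
      rw [mul_comm, add_assoc, Nat.mul_add_div (by omega), Nat.div_eq_of_lt hlt, add_zero]
    have hmod : ((K + m) * n + offset n v i + s) % n = offset n v i + s := by
      rw [mul_comm, add_assoc, Nat.mul_add_mod, Nat.mod_eq_of_lt hlt]
    have hsample : pooledSample w n ((K + m) * n + offset n v i + s) x = i := by
      unfold pooledSample
      rw [dif_neg (by rw [hdiv]; omega), hdiv, hmod, Nat.add_sub_cancel_left, ← hv]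
      refine firstArm_eq (by omega) fun j hj => ?_
      have := offset_add_draws_le_offset n v hj
      omega
    rw [h, hsample]
  have hd' : (draws n v i : ℝ) ≠ 0 := by exact_mod_cast hd.ne'
  unfold batchMean
  rw [Finset.sum_congr rfl hx, Finset.sum_add_distrib]
  simp
  field_simp

/-- An arm without draws has empirical mean `0` instead of `P i` plus noise. This is harmless: since
`n > K`, no draws means target proportion zero. -/
lemma pool_succ (h : IsPooledRun P w n x z) (hn : K < n) (m : ℕ) (i : Fin K) :
    pool w n x (m + 1) i = (1 - (w (pool w n x m) : Fin K → ℝ) i) * pool w n x m i +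
      (w (pool w n x m) : Fin K → ℝ) i *
        (P i + batchMean n z (K + m) (w (pool w n x m)) i) := by
  simp only [pool]
  rcases Nat.eq_zero_or_pos (draws n (w (pool w n x m)) i) with hd | hd
  · have h1 := le_draws n (w (pool w n x m)) i
    have h0 := (w (pool w n x m)).2.1 i
    have hpos : (0 : ℝ) < ((n - K : ℕ) : ℝ) := by exact_mod_cast Nat.sub_pos_of_lt hn
    rw [hd, Nat.cast_zero] at h1
    have : (w (pool w n x m) : Fin K → ℝ) i = 0 :=
      le_antisymm (nonpos_of_mul_nonpos_left h1 hpos) h0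
    rw [this]
    ring
  · rw [h.batchMean_eq hn.le m i hd]

end IsPooledRun

/-- Sum over the arms of half the squared normalised noise in the first `K` batches. -/
def initialEnergy (K n : ℕ) (z : ℕ → ℝ) : ℝ :=
  ∑ i : Fin K, (n : ℝ) * ((∑ s ∈ Finset.range n, z (i * n + s)) / n) ^ 2 / 2

/-- Sum over the arms of half the squared normalised noise in batch `b`. -/
def batchEnergy (n : ℕ) (z : ℕ → ℝ) (b : ℕ) (v : stdSimplex ℝ (Fin K)) : ℝ :=
  ∑ i, (draws n v i : ℝ) * batchMean n z b v i ^ 2 / 2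

/-- The energy of the noise up to the computation of `pool M`. -/
def energy (w : Allocation K) (n : ℕ) (x z : ℕ → ℝ) (M : ℕ) : ℝ :=
  initialEnergy K n z + ∑ m ∈ Finset.range M, batchEnergy n z (K + m) (w (pool w n x m))

lemma energy_succ (w : Allocation K) (n : ℕ) (x z : ℕ → ℝ) (M : ℕ) :
    energy w n x z (M + 1) = energy w n x z M + batchEnergy n z (K + M) (w (pool w n x M)) := by
  rw [energy, Finset.sum_range_succ, ← add_assoc]; rfl

lemma batchEnergy_nonneg (n : ℕ) (z : ℕ → ℝ) (b : ℕ) (v : stdSimplex ℝ (Fin K)) :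
    0 ≤ batchEnergy n z b v := Finset.sum_nonneg fun i _ => by positivity

lemma energy_mono (w : Allocation K) (n : ℕ) (x z : ℕ → ℝ) : Monotone (energy w n x z) :=
  monotone_nat_of_le_succ fun M => by
    rw [energy_succ]
    linarith [batchEnergy_nonneg n z (K + M) (w (pool w n x M))]

/-- The energy of the noise bounds the deviations of all pooled means. -/
lemma IsPooledRun.potential_le_energy [NeZero K] {P : Fin K → ℝ} {w : Allocation K} {n : ℕ}
    {x z : ℕ → ℝ} (h : IsPooledRun P w n x z) (hn : K < n) (M : ℕ) :
    ((n - K : ℕ) : ℝ) * ∑ i, (pool w n x M i - P i) ^ 2 / 2 +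
      ((n - K : ℕ) : ℝ) * ∑ m ∈ Finset.range M,
        ∑ i, (w (pool w n x m) : Fin K → ℝ) i * ((pool w n x m i - P i) ^ 2 / 2) ≤
      energy w n x z M := by
  induction M with
  | zero =>
    simp only [Finset.range_zero, Finset.sum_empty, mul_zero, add_zero, energy, initialEnergy]
    rw [Finset.mul_sum]
    refine Finset.sum_le_sum fun i _ => ?_
    rw [h.pool_zero (by omega), add_sub_cancel_left]
    have : ((n - K : ℕ) : ℝ) ≤ n := by exact_mod_cast Nat.sub_le n K
    rw [mul_div_assoc]
    gcongr
  | succ M ih =>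
    rw [energy_succ]
    refine le_trans ?_ (add_le_add_left ih _)
    -- One batch: the new potential plus the cost paid is at most the old potential plus the energy
    -- of the batch.
    have hstep : ((n - K : ℕ) : ℝ) * ∑ i, (pool w n x (M + 1) i - P i) ^ 2 / 2 +
        ((n - K : ℕ) : ℝ) *
          ∑ i, (w (pool w n x M) : Fin K → ℝ) i * ((pool w n x M i - P i) ^ 2 / 2) ≤
        ((n - K : ℕ) : ℝ) * ∑ i, (pool w n x M i - P i) ^ 2 / 2 +
          batchEnergy n z (K + M) (w (pool w n x M)) := by
      simp only [batchEnergy, Finset.mul_sum, ← Finset.sum_add_distrib]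
      refine Finset.sum_le_sum fun i _ => ?_
      rw [h.pool_succ hn]
      set v := w (pool w n x M)
      set N : ℝ := ((n - K : ℕ) : ℝ)
      set ξ := batchMean n z (K + M) v i
      have h0 : 0 ≤ (v : Fin K → ℝ) i := v.2.1 i
      have h1 : (v : Fin K → ℝ) i ≤ 1 := by
        rw [← (v.2.2 : ∑ i, (v : Fin K → ℝ) i = 1)]
        exact Finset.single_le_sum (fun j _ => v.2.1 j) (Finset.mem_univ i)
      have hd := le_draws n v i
      have hN : 0 ≤ N := Nat.cast_nonneg _
      set q := (v : Fin K → ℝ) i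
      set D := pool w n x M i - P i
      have e : (1 - q) * pool w n x M i + q * (P i + ξ) - P i = (1 - q) * D + q * ξ := by
        simp only [D]; ring
      rw [e]
      -- Convexity of the square; the defect is `q (1 - q) (D - ξ)²`.
      have hconv : ((1 - q) * D + q * ξ) ^ 2 ≤ (1 - q) * D ^ 2 + q * ξ ^ 2 := by
        nlinarith [mul_nonneg (mul_nonneg h0 (sub_nonneg.2 h1)) (sq_nonneg (D - ξ))]
      have h3 : N * ((1 - q) * D + q * ξ) ^ 2 ≤ N * ((1 - q) * D ^ 2 + q * ξ ^ 2) :=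
        mul_le_mul_of_nonneg_left hconv hN
      have h4 : q * N * ξ ^ 2 ≤ draws n v i * ξ ^ 2 := mul_le_mul_of_nonneg_right hd (sq_nonneg ξ)
      linarith
    rw [Finset.sum_range_succ, mul_add]
    linarith

/-! ### Exponential moments and ties of the pooled means -/

/-- Fubini for null events: when the two arguments use disjoint coordinates, the second may be
replaced by an independent copy and the first frozen. -/
lemma ae_noise_diag {S T : Finset ℕ} (hST : Disjoint S T) {E : (ℕ → ℝ) → (ℕ → ℝ) → Prop}
    (hE : MeasurableSet {q : (ℕ → ℝ) × (ℕ → ℝ) | E q.1 q.2})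
    (h1 : ∀ y, DependsOnlyOn (fun z => E z y) S) (h2 : ∀ z, DependsOnlyOn (E z) T)
    (h : ∀ z, ∀ᵐ y ∂noiseLaw, ¬ E z y) : ∀ᵐ z ∂noiseLaw, ¬ E z z := by
  classical
  have hf : Measurable (Function.uncurry fun z y => if E z y then (1 : ℝ≥0∞) else 0) :=
    Measurable.ite hE measurable_const measurable_const
  have key := lintegral_noise_diag hST hf (fun y z z' hz => by simp only [h1 y z z' hz])
    (fun z y y' hy => by simp only [h2 z y y' hy])
  have h0 : ∀ z, ∫⁻ y, (if E z y then (1 : ℝ≥0∞) else 0) ∂noiseLaw = 0 := fun z =>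
    lintegral_eq_zero_of_ae_eq_zero ((h z).mono fun y hy => by simp [hy])
  simp only [h0, lintegral_zero] at key
  have hd : Measurable fun z => if E z z then (1 : ℝ≥0∞) else 0 :=
    hf.comp (measurable_id.prodMk measurable_id)
  rw [lintegral_eq_zero_iff hd] at key
  filter_upwards [key] with z hz hEz
  simp [hEz] at hz

/-- Conditioning on the past: `S` carries the past and `T` the new batch, and `C` bounds the
conditional expectation of `g` uniformly in the past. -/
lemma lintegral_noise_mul_le {S T : Finset ℕ} (hST : Disjoint S T) {u : (ℕ → ℝ) → ℝ≥0∞}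
    {g : (ℕ → ℝ) → (ℕ → ℝ) → ℝ≥0∞} (hu : Measurable u) (hg : Measurable (Function.uncurry g))
    (huS : DependsOnlyOn u S) (hgS : ∀ y, DependsOnlyOn (fun z => g z y) S)
    (hgT : ∀ z, DependsOnlyOn (g z) T) {C : ℝ≥0∞} (hC : ∀ z, ∫⁻ y, g z y ∂noiseLaw ≤ C) :
    ∫⁻ z, u z * g z z ∂noiseLaw ≤ (∫⁻ z, u z ∂noiseLaw) * C := by
  rw [lintegral_noise_diag (f := fun z y => u z * g z y) hST ((hu.comp measurable_fst).mul hg)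
    (fun y z z' h => by simp only [huS z z' h, hgS y z z' h])
    (fun z y y' h => by simp only [hgT z y y' h]), ← lintegral_mul_const _ hu]
  refine lintegral_mono fun z => ?_
  have hz : Measurable (g z) := hg.comp measurable_prodMk_left
  rw [lintegral_const_mul _ hz]
  gcongr
  exact hC z

/-- With the coordinates in `T` frozen, the left side is a nondegenerate Gaussian and the right side
a constant. -/
lemma noise_block_ne_ae {o d : ℕ} (hd : 0 < d) {c : ℝ} (hc : c ≠ 0) {T : Finset ℕ}
    (hT : Disjoint T (Finset.Ico o (o + d))) {g : (ℕ → ℝ) → ℝ} (hg : Measurable g)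
    (hgT : DependsOnlyOn g T) :
    ∀ᵐ z ∂noiseLaw, c * ∑ s ∈ Finset.range d, z (o + s) ≠ g z := by
  have hsum : ∀ z : ℕ → ℝ, c * ∑ s ∈ Finset.range d, z (o + s) =
      ∑ k ∈ Finset.Ico o (o + d), c * z k := by
    intro z
    rw [← Finset.mul_sum, Finset.sum_Ico_eq_sum_range, Nat.add_sub_cancel_left]
  simp only [hsum]
  refine ae_noise_diag (E := fun z y => ∑ k ∈ Finset.Ico o (o + d), c * y k = g z) hT ?_ ?_ ?_ ?_
  · exact measurableSet_eq_fun (by fun_prop) (hg.comp measurable_fst)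
  · intro y z z' h
    simp only [hgT z z' h]
  · intro z y y' h
    have : ∑ k ∈ Finset.Ico o (o + d), c * y k = ∑ k ∈ Finset.Ico o (o + d), c * y' k :=
      Finset.sum_congr rfl fun k hk => by rw [h k hk]
    simp only [this]
  · intro z
    exact noise_sum_ne_ae (k := o) (c := fun _ => c) (by simp [hd]) hc _

/-- The rewards `x` of Pooled Allocation as a nonanticipating function of the noise. -/
structure IsPooledProcess [NeZero K] (P : Fin K → ℝ) (w : Allocation K) (n : ℕ)
    (x : (ℕ → ℝ) → ℕ → ℝ) : Prop where
  lt : K < n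
  measurable_allocation : Measurable w
  measurable : Measurable x
  dependsOnlyOn : ∀ t, DependsOnlyOn (fun z => x z t) (Set.Iic t)
  run : ∀ z, IsPooledRun P w n (x z) z

lemma isPooledProcess_reward [NeZero K] (w : Allocation K) (hw : Measurable w) (B : ℕ → ℕ) {T : ℕ}
    (P : Fin K → ℝ) (hn : K < T / B T) :
    IsPooledProcess P w (T / B T) fun z => (pooledAllocation w hw B).reward T P z where
  lt := hn
  measurable_allocation := hw
  measurable := Algorithm.measurable_reward_seq _ T P
  dependsOnlyOn t := Algorithm.reward_dependsOnlyOn _ T P t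
  run z := isPooledRun_reward w hw B T P z hn.le

lemma measurable_batchEnergy {α : Type*} [MeasurableSpace α] (n b : ℕ)
    {x : α → ℕ → ℝ} (hx : Measurable x) {v : α → stdSimplex ℝ (Fin K)} (hv : Measurable v) :
    Measurable fun a => batchEnergy n (x a) b (v a) := by
  refine Finset.measurable_sum _ fun i _ => Measurable.div_const (Measurable.mul ?_ ?_) _
  · exact (measurable_from_top (f := (Nat.cast : ℕ → ℝ))).comp ((measurable_draws n i).comp hv)
  · exact (measurable_batchMean n b i hx hv).pow_const 2

lemma batchEnergy_dependsOnlyOn {n : ℕ} (hn : K ≤ n) (b : ℕ) (v : stdSimplex ℝ (Fin K)) :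
    DependsOnlyOn (fun z => batchEnergy n z b v) (Set.Ico (b * n) ((b + 1) * n)) := by
  intro z z' h
  unfold batchEnergy
  refine Finset.sum_congr rfl fun i _ => ?_
  rw [batchMean_congr hn (fun k h1 h2 => h k (Set.mem_Ico.2 ⟨h1, h2⟩))]

lemma initialEnergy_dependsOnlyOn (n : ℕ) :
    DependsOnlyOn (initialEnergy K n) (Set.Iio (K * n)) := by
  intro z z' h
  unfold initialEnergy
  refine Finset.sum_congr rfl fun i _ => ?_
  have : ∀ s ∈ Finset.range n, z (i * n + s) = z' (i * n + s) := by
    intro s hs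
    have h1 := Finset.mem_range.1 hs
    have h2 : ((i : ℕ) + 1) * n ≤ K * n := Nat.mul_le_mul_right n i.2
    rw [add_mul] at h2
    exact h _ (Set.mem_Iio.2 (by omega))
  rw [Finset.sum_congr rfl this]

/-- A nonzero proportion guarantees at least one draw of arm `i`, and the rounds of arm `j` are
disjoint from its block. Only one of the two proportions has to be nonzero. -/
lemma batch_ne_ae {n : ℕ} (hn : K < n) (b : ℕ) (v : stdSimplex ℝ (Fin K)) {i j : Fin K}
    (hij : i ≠ j) (hi : (v : Fin K → ℝ) i ≠ 0) (α β : ℝ) :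
    ∀ᵐ y ∂noiseLaw, α + (v : Fin K → ℝ) i * batchMean n y b v i ≠
      β + (v : Fin K → ℝ) j * batchMean n y b v j := by
  have hvi : 0 < (v : Fin K → ℝ) i := lt_of_le_of_ne (v.2.1 i) hi.symm
  have hpos : (0 : ℝ) < ((n - K : ℕ) : ℝ) := by exact_mod_cast Nat.sub_pos_of_lt hn
  have hd : (0 : ℝ) < draws n v i := (mul_pos hvi hpos).trans_le (le_draws n v i)
  have hd' : 0 < draws n v i := by exact_mod_cast hd
  have hm : Measurable fun y => batchMean n y b v j :=
    measurable_batchMean n b j measurable_id measurable_const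
  have hdisj : Disjoint (Finset.Ico (b * n + offset n v j) (b * n + offset n v j + draws n v j))
      (Finset.Ico (b * n + offset n v i) (b * n + offset n v i + draws n v i)) := by
    rw [Finset.disjoint_left]
    intro k hk hk'
    rw [Finset.mem_Ico] at hk hk'
    rcases lt_or_gt_of_ne hij with hlt | hlt
    · have := offset_add_draws_le_offset n v hlt; omega
    · have := offset_add_draws_le_offset n v hlt; omega
  have key := noise_block_ne_ae hd' (c := (v : Fin K → ℝ) i / draws n v i) (by positivity) hdisj
    (g := fun y => β + (v : Fin K → ℝ) j * batchMean n y b v j - α) (by fun_prop) (by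
      intro y y' hy
      simp only [batchMean]
      have : ∀ s ∈ Finset.range (draws n v j),
          y (b * n + offset n v j + s) = y' (b * n + offset n v j + s) := fun s hs =>
        hy _ (by simpa using Finset.mem_range.1 hs)
      rw [Finset.sum_congr rfl this])
  filter_upwards [key] with y hy heq
  apply hy
  rw [← heq, batchMean]
  ring

namespace IsPooledProcess

variable [NeZero K] {P : Fin K → ℝ} {w : Allocation K} {n : ℕ} {x : (ℕ → ℝ) → ℕ → ℝ}

lemma measurable_pool (h : IsPooledProcess P w n x) (m : ℕ) :
    Measurable fun z => pool w n (x z) m :=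
  (BestArm.measurable_pool h.measurable_allocation n m).comp h.measurable

lemma pool_dependsOnlyOn (h : IsPooledProcess P w n x) (m : ℕ) :
    DependsOnlyOn (fun z => pool w n (x z) m) (Set.Iio ((K + m) * n)) := fun z z' hz =>
  BestArm.pool_dependsOnlyOn h.lt.le w m _ _ fun k hk => h.dependsOnlyOn k z z' fun j hj =>
    hz j (Set.mem_Iio.2 ((Set.mem_Iic.1 hj).trans_lt (Set.mem_Iio.1 hk)))

lemma measurable_energy (h : IsPooledProcess P w n x) (M : ℕ) :
    Measurable fun z => energy w n (x z) z M := by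
  refine Measurable.add (Finset.measurable_sum _ fun i _ => ?_)
    (Finset.measurable_sum _ fun m _ => ?_)
  · fun_prop
  · exact measurable_batchEnergy _ _ measurable_id
      (h.measurable_allocation.comp (h.measurable_pool m))

lemma energy_dependsOnlyOn (h : IsPooledProcess P w n x) (M : ℕ) :
    DependsOnlyOn (fun z => energy w n (x z) z M) (Set.Iio ((K + M) * n)) := by
  intro z z' hz
  have hle : ∀ m ≤ M, (K + m) * n ≤ (K + M) * n := fun m hm => Nat.mul_le_mul_right n (by omega)
  simp only [energy]
  congr 1
  · exact initialEnergy_dependsOnlyOn n z z' fun k hk => hz k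
      (Set.mem_Iio.2 ((Set.mem_Iio.1 hk).trans_le (by simpa using hle 0 (Nat.zero_le _))))
  · refine Finset.sum_congr rfl fun m hm => ?_
    have hm' := Finset.mem_range.1 hm
    have hp : pool w n (x z) m = pool w n (x z') m := h.pool_dependsOnlyOn m z z' fun k hk => hz k
      (Set.mem_Iio.2 ((Set.mem_Iio.1 hk).trans_le (hle m hm'.le)))
    rw [hp]
    exact batchEnergy_dependsOnlyOn h.lt.le _ _ z z' fun k hk => hz k
      (Set.mem_Iio.2 ((Set.mem_Ico.1 hk).2.trans_le (hle (m + 1) hm')))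

/-- Exponential moments of the energy of the noise. -/
lemma lintegral_exp_energy_le (h : IsPooledProcess P w n x) {a : ℝ} (ha : 0 ≤ a) (M : ℕ) :
    ∫⁻ z, ENNReal.ofReal (Real.exp (a * energy w n (x z) z M)) ∂noiseLaw ≤
      squareMoment a ^ (K * (M + 1)) := by
  induction M with
  | zero =>
    simp only [energy, Finset.range_zero, Finset.sum_empty, add_zero, initialEnergy, zero_add,
      mul_one]
    refine lintegral_exp_blocks_le ha (fun i : Fin K => i * n) (fun _ => n) fun i j hij => ?_
    have h2 : ((i : ℕ) + 1) * n ≤ j * n := Nat.mul_le_mul_right n hij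
    rwa [add_mul, one_mul] at h2
  | succ M ih =>
    have hv : Measurable fun z => w (pool w n (x z) M) :=
      h.measurable_allocation.comp (h.measurable_pool M)
    have hE : Measurable fun q : (ℕ → ℝ) × (ℕ → ℝ) =>
        batchEnergy n q.2 (K + M) (w (pool w n (x q.1) M)) :=
      measurable_batchEnergy n _ measurable_snd (hv.comp measurable_fst)
    have hm := h.measurable_energy M
    simp_rw [energy_succ, mul_add, Real.exp_add, ENNReal.ofReal_mul (Real.exp_pos _).le]
    have hu : Measurable fun z => ENNReal.ofReal (Real.exp (a * energy w n (x z) z M)) := by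
      fun_prop
    have hg : Measurable (Function.uncurry fun z y =>
        ENNReal.ofReal (Real.exp (a * batchEnergy n y (K + M) (w (pool w n (x z) M))))) :=
      (hE.const_mul a).exp.ennreal_ofReal
    -- Given the past, the proportions of batch `K + M` are fixed, so its energy is a sum over
    -- disjoint fixed blocks and contributes a factor of at most `squareMoment a ^ K`.
    refine (lintegral_noise_mul_le (S := Finset.range ((K + M) * n))
      (T := Finset.Ico ((K + M) * n) ((K + M + 1) * n)) ?_ hu hg ?_ ?_ ?_
      (C := squareMoment a ^ K) ?_).trans ?_
    · rw [Finset.disjoint_left]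
      intro k hk hk'
      have := Finset.mem_range.1 hk
      have := Finset.mem_Ico.1 hk'
      omega
    · intro z z' hz
      have h1 := h.energy_dependsOnlyOn M z z' fun k hk => hz k (by simpa using hk)
      simp only at h1 ⊢
      rw [h1]
    · intro y z z' hz
      have h2 := h.pool_dependsOnlyOn M z z' fun k hk => hz k (by simpa using hk)
      simp only at h2 ⊢
      rw [h2]
    · intro z y y' hy
      have h3 := batchEnergy_dependsOnlyOn h.lt.le (K + M) (w (pool w n (x z) M)) y y'
        fun k hk => hy k (by simpa using hk)
      simp only at h3 ⊢
      rw [h3]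
    · intro z
      exact lintegral_exp_blocks_le ha
        (fun i => (K + M) * n + offset n (w (pool w n (x z) M)) i)
        (draws n (w (pool w n (x z) M))) fun i j hij => by
          have := offset_add_draws_le_offset n (w (pool w n (x z) M)) hij
          omega
    · calc _ ≤ squareMoment a ^ (K * (M + 1)) * squareMoment a ^ K := by gcongr
        _ = _ := by rw [← pow_add]; ring_nf

/-- Chernoff's bound: Markov's inequality for the exponential moment of order `a`. -/
lemma measure_le_energy (h : IsPooledProcess P w n x) {a : ℝ} (ha : 0 ≤ a) (M : ℕ) (r : ℝ) :
    noiseLaw {z | r ≤ energy w n (x z) z M} ≤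
      ENNReal.ofReal (Real.exp (-(a * r))) * squareMoment a ^ (K * (M + 1)) := by
  have hm := h.measurable_energy M
  have hmarkov := mul_meas_ge_le_lintegral (μ := noiseLaw)
    (f := fun z => ENNReal.ofReal (Real.exp (a * energy w n (x z) z M)))
    (by fun_prop) (ENNReal.ofReal (Real.exp (a * r)))
  have hsub : noiseLaw {z | r ≤ energy w n (x z) z M} ≤ noiseLaw
      {z | ENNReal.ofReal (Real.exp (a * r)) ≤
        ENNReal.ofReal (Real.exp (a * energy w n (x z) z M))} := by
    refine measure_mono fun z (hz : r ≤ _) => ?_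
    exact ENNReal.ofReal_le_ofReal (Real.exp_le_exp.2 (mul_le_mul_of_nonneg_left hz ha))
  have hone : ENNReal.ofReal (Real.exp (-(a * r))) * ENNReal.ofReal (Real.exp (a * r)) = 1 := by
    rw [← ENNReal.ofReal_mul (Real.exp_pos _).le, ← Real.exp_add]
    simp
  calc noiseLaw {z | r ≤ energy w n (x z) z M}
      = ENNReal.ofReal (Real.exp (-(a * r))) * (ENNReal.ofReal (Real.exp (a * r)) *
          noiseLaw {z | r ≤ energy w n (x z) z M}) := by rw [← mul_assoc, hone, one_mul]
    _ ≤ _ := by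
      gcongr
      exact ((mul_le_mul_right hsub _).trans hmarkov).trans (h.lintegral_exp_energy_le ha M)

/-- Almost surely the pooled means of two arms are never equal. -/
lemma pool_ne_ae (h : IsPooledProcess P w n x) {i j : Fin K} (hij : i ≠ j) (m : ℕ) :
    ∀ᵐ z ∂noiseLaw, pool w n (x z) m i ≠ pool w n (x z) m j := by
  have hn := h.lt
  induction m with
  | zero =>
    have hn0 : 0 < n := by omega
    have hn' : (n : ℝ) ≠ 0 := by exact_mod_cast hn0.ne'
    have hdisj : Disjoint (Finset.Ico (j * n) (j * n + n)) (Finset.Ico (i * n) (i * n + n)) := by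
      rw [Finset.disjoint_left]
      intro k hk hk'
      rw [Finset.mem_Ico] at hk hk'
      rcases lt_or_gt_of_ne hij with hlt | hlt
      · have h2 : ((i : ℕ) + 1) * n ≤ j * n := Nat.mul_le_mul_right n hlt
        rw [add_mul] at h2
        omega
      · have h2 : ((j : ℕ) + 1) * n ≤ i * n := Nat.mul_le_mul_right n hlt
        rw [add_mul] at h2
        omega
    have key := noise_block_ne_ae hn0 (c := (n : ℝ)⁻¹) (by positivity) hdisj
      (g := fun y => P j + (∑ s ∈ Finset.range n, y (j * n + s)) / n - P i) (by fun_prop) (by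
        intro y y' hy
        have : ∀ s ∈ Finset.range n, y (j * n + s) = y' (j * n + s) := fun s hs =>
          hy _ (by simpa using Finset.mem_range.1 hs)
        simp only [Finset.sum_congr rfl this])
    filter_upwards [key] with z hz heq
    apply hz
    rw [(h.run z).pool_zero hn0, (h.run z).pool_zero hn0] at heq
    rw [← heq]
    ring
  | succ m ih =>
    have hv : Measurable fun z => w (pool w n (x z) m) :=
      h.measurable_allocation.comp (h.measurable_pool m)
    have hvi : ∀ i, Measurable fun z => (w (pool w n (x z) m) : Fin K → ℝ) i := fun i =>
      (measurable_simplexCoord i).comp hv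
    have hpi : ∀ i, Measurable fun z => pool w n (x z) m i := fun i =>
      (measurable_pi_apply i).comp (h.measurable_pool m)
    -- The next pooled mean, with the past computed from `z` and the new batch from a separate noise
    -- `y`.
    let F : Fin K → (ℕ → ℝ) → (ℕ → ℝ) → ℝ := fun i z y =>
      ((1 - (w (pool w n (x z) m) : Fin K → ℝ) i) * pool w n (x z) m i +
        (w (pool w n (x z) m) : Fin K → ℝ) i * P i) +
      (w (pool w n (x z) m) : Fin K → ℝ) i * batchMean n y (K + m) (w (pool w n (x z) m)) i
    have hF : ∀ i, Measurable fun q : (ℕ → ℝ) × (ℕ → ℝ) => F i q.1 q.2 := by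
      intro i
      have h1 : Measurable fun q : (ℕ → ℝ) × (ℕ → ℝ) => (w (pool w n (x q.1) m) : Fin K → ℝ) i :=
        (hvi i).comp measurable_fst
      have h2 : Measurable fun q : (ℕ → ℝ) × (ℕ → ℝ) => pool w n (x q.1) m i :=
        (hpi i).comp measurable_fst
      have h3 : Measurable fun q : (ℕ → ℝ) × (ℕ → ℝ) =>
          batchMean n q.2 (K + m) (w (pool w n (x q.1) m)) i :=
        measurable_batchMean n (K + m) i measurable_snd (hv.comp measurable_fst)
      exact (((measurable_const.sub h1).mul h2).add (h1.mul measurable_const)).add (h1.mul h3)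
    -- The absence of an earlier tie is kept in the event because, if both proportions vanish, the
    -- batch changes neither mean and only the induction hypothesis excludes a tie.
    have key : ∀ᵐ z ∂noiseLaw, ¬ (F i z z = F j z z ∧
        pool w n (x z) m i ≠ pool w n (x z) m j) := by
      refine ae_noise_diag (S := Finset.range ((K + m) * n))
        (T := Finset.Ico ((K + m) * n) ((K + m + 1) * n))
        (E := fun z y => F i z y = F j z y ∧ pool w n (x z) m i ≠ pool w n (x z) m j)
        ?_ ?_ ?_ ?_ ?_
      · rw [Finset.disjoint_left]
        intro k hk hk'
        have := Finset.mem_range.1 hk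
        have := Finset.mem_Ico.1 hk'
        omega
      · exact (measurableSet_eq_fun (hF i) (hF j)).inter
          (measurableSet_eq_fun ((hpi i).comp measurable_fst) ((hpi j).comp measurable_fst)).compl
      · intro y z z' hz
        have h2 := h.pool_dependsOnlyOn m z z' fun k hk => hz k (by simpa using hk)
        simp only [F] at h2 ⊢
        rw [h2]
      · intro z y y' hy
        simp only [F]
        rw [batchMean_congr hn.le (fun k h1 h2 => hy k (by simpa using ⟨h1, h2⟩)),
          batchMean_congr hn.le (fun k h1 h2 => hy k (by simpa using ⟨h1, h2⟩))]
      · intro z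
        by_cases hi : (w (pool w n (x z) m) : Fin K → ℝ) i = 0
        · by_cases hj : (w (pool w n (x z) m) : Fin K → ℝ) j = 0
          · refine Eventually.of_forall fun y hy => hy.2 ?_
            simpa [F, hi, hj] using hy.1
          · filter_upwards [batch_ne_ae hn (K + m) _ hij.symm hj _ _] with y hy hy'
            exact hy hy'.1.symm
        · filter_upwards [batch_ne_ae hn (K + m) _ hij hi _ _] with y hy hy'
          exact hy hy'.1
    filter_upwards [ih, key] with z hz hkey heq
    refine hkey ⟨?_, hz⟩
    rw [(h.run z).pool_succ hn, (h.run z).pool_succ hn] at heq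
    simp only [F]
    linarith

end IsPooledProcess

/-! ### Votes, batch schedules and exponents -/

lemma simplex_nonneg (v : stdSimplex ℝ (Fin K)) (i : Fin K) : 0 ≤ (v : Fin K → ℝ) i := v.2.1 i

lemma sum_mul_gaussKL (v : stdSimplex ℝ (Fin K)) (P Q : Fin K → ℝ) :
    ∑ j, ENNReal.ofReal ((v : Fin K → ℝ) j) * gaussKL (Q j) (P j) =
      ENNReal.ofReal (∑ j, (v : Fin K → ℝ) j * ((Q j - P j) ^ 2 / 2)) := by
  rw [ENNReal.ofReal_sum_of_nonneg fun j _ => mul_nonneg (simplex_nonneg v j)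
    (div_nonneg (sq_nonneg _) zero_le_two)]
  exact Finset.sum_congr rfl fun j _ => (ENNReal.ofReal_mul (simplex_nonneg v j)).symm

lemma victories_congr [NeZero K] {w : Allocation K} {B n : ℕ} (hn : K ≤ n) {x y : ℕ → ℝ}
    (h : ∀ k < B * n, x k = y k) : victories w B n x = victories w B n y := by
  funext i
  unfold victories
  congr 1
  refine Finset.filter_congr fun m hm => ?_
  have hm' := Finset.mem_range.1 hm
  have : pool w n x m = pool w n y m := pool_dependsOnlyOn hn w m x y fun k hk =>
    h k ((Set.mem_Iio.1 hk).trans_le (Nat.mul_le_mul_right n (by omega)))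
  rw [this]

/-- If the arm `i` does not win the vote, at least half of the votes are for other arms. -/
lemma half_votes_of_argmax_ne [NeZero K] {w : Allocation K} {B n : ℕ} {x : ℕ → ℝ} {i : Fin K}
    (h : argmax (victories w B n x) ≠ i) :
    B - K ≤ 2 * ((Finset.range (B - K)).filter fun m => argmax (pool w n x m) ≠ i).card := by
  set j := argmax (victories w B n x) with hj
  have h1 : victories w B n x i ≤ victories w B n x j := argmax_spec (victories w B n x) i
  have h2 : victories w B n x i +
      ((Finset.range (B - K)).filter fun m => argmax (pool w n x m) ≠ i).card = B - K := by
    have := Finset.card_filter_add_card_filter_not (s := Finset.range (B - K))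
      (fun m => argmax (pool w n x m) = i)
    simpa [victories] using this
  have h3 : victories w B n x j ≤
      ((Finset.range (B - K)).filter fun m => argmax (pool w n x m) ≠ i).card := by
    refine Finset.card_le_card fun m hm => ?_
    rw [Finset.mem_filter] at hm ⊢
    exact ⟨hm.1, by rw [hm.2]; exact h⟩
  omega

/-- Ties must be excluded here: an arm losing only by the least-index rule is still best, and the
game then gives no lower bound on the cost. -/
lemma not_isBest_of_argmax_ne [NeZero K] {Q : Fin K → ℝ} (hQ : ∀ i j, i ≠ j → Q i ≠ Q j)
    {i : Fin K} (h : argmax Q ≠ i) : ¬ IsBest Q i := fun hi =>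
  hQ _ _ h (le_antisymm (hi _) (argmax_spec Q i))

/-- A wrong recommendation needs a large energy of the noise. -/
lemma IsPooledRun.le_energy_of_error [NeZero K] {P : Fin K → ℝ} {w : Allocation K} {n B : ℕ}
    {x z : ℕ → ℝ} (h : IsPooledRun P w n x z) (hn : K < n) {i : Fin K} {c : ℝ} (hc : 0 ≤ c)
    (hcost : ∀ Q, ¬ IsBest Q i → c ≤ ∑ j, (w Q : Fin K → ℝ) j * ((Q j - P j) ^ 2 / 2))
    (hne : ∀ m, ∀ j k, j ≠ k → pool w n x m j ≠ pool w n x m k)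
    (herr : argmax (victories w B n x) ≠ i) :
    ((n - K : ℕ) : ℝ) * ((B - K : ℕ) : ℝ) * (c / 2) ≤ energy w n x z (B - K) := by
  have hpot := h.potential_le_energy hn (B - K)
  have hnn : ∀ Q, 0 ≤ ∑ j, (w Q : Fin K → ℝ) j * ((Q j - P j) ^ 2 / 2) := fun Q =>
    Finset.sum_nonneg fun j _ => mul_nonneg ((w Q).2.1 j) (by positivity)
  have hcount : ((B - K : ℕ) : ℝ) * (c / 2) ≤ ∑ m ∈ Finset.range (B - K),
      ∑ j, (w (pool w n x m) : Fin K → ℝ) j * ((pool w n x m j - P j) ^ 2 / 2) := by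
    set W := (Finset.range (B - K)).filter fun m => argmax (pool w n x m) ≠ i with hW
    have h2 : ((B - K : ℕ) : ℝ) ≤ 2 * W.card := by
      exact_mod_cast half_votes_of_argmax_ne herr
    -- Only the wrong votes are charged: they are at least half of all votes, and each costs at
    -- least `c`.
    calc ((B - K : ℕ) : ℝ) * (c / 2) ≤ (2 * W.card) * (c / 2) := by gcongr
      _ = ∑ _m ∈ W, c := by rw [Finset.sum_const, nsmul_eq_mul]; ring
      _ ≤ ∑ m ∈ W, ∑ j, (w (pool w n x m) : Fin K → ℝ) j * ((pool w n x m j - P j) ^ 2 / 2) :=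
        Finset.sum_le_sum fun m hm => hcost _
          (not_isBest_of_argmax_ne (hne m) (Finset.mem_filter.1 hm).2)
      _ ≤ _ := Finset.sum_le_sum_of_subset_of_nonneg (Finset.filter_subset _ _)
          fun m _ _ => hnn _
  have hN : (0 : ℝ) ≤ ((n - K : ℕ) : ℝ) := Nat.cast_nonneg _
  have h3 := mul_le_mul_of_nonneg_left hcount hN
  have h4 : 0 ≤ ((n - K : ℕ) : ℝ) * ∑ j, (pool w n x (B - K) j - P j) ^ 2 / 2 := by positivity
  rw [mul_assoc]
  linarith

lemma IsBatchSchedule.tendsto_div {B : ℕ → ℕ} (hB : IsBatchSchedule B) :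
    Tendsto (fun T : ℕ => (B T : ℝ) / T) atTop (nhds 0) := hB.2.tendsto_div_nhds_zero

lemma IsBatchSchedule.tendsto_inv {B : ℕ → ℕ} (hB : IsBatchSchedule B) :
    Tendsto (fun T : ℕ => ((B T : ℝ))⁻¹) atTop (nhds 0) :=
  tendsto_inv_atTop_zero.comp (tendsto_natCast_atTop_atTop.comp hB.1)

lemma IsBatchSchedule.eventually_lt {B : ℕ → ℕ} (hB : IsBatchSchedule B) (k : ℕ) :
    ∀ᶠ T in atTop, k < B T ∧ k < T / B T := by
  have h1 : ∀ᶠ T : ℕ in atTop, (B T : ℝ) / T < 1 / (k + 1) :=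
    hB.tendsto_div.eventually (gt_mem_nhds (by positivity))
  filter_upwards [hB.1.eventually_gt_atTop k, h1, eventually_gt_atTop 0] with T hT hT1 hT0
  refine ⟨hT, ?_⟩
  rw [← Nat.succ_le_iff, Nat.le_div_iff_mul_le (by omega)]
  have hT0' : (0 : ℝ) < T := by exact_mod_cast hT0
  rw [div_lt_div_iff₀ hT0' (by positivity)] at hT1
  have : B T * (k + 1) < 1 * T := by exact_mod_cast hT1
  rw [Nat.succ_eq_add_one, mul_comm]
  omega

/-- Almost all rounds belong to batches whose pooled means have a vote. -/
lemma IsBatchSchedule.tendsto_rounds {B : ℕ → ℕ} (hB : IsBatchSchedule B) (K : ℕ) :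
    Tendsto (fun T : ℕ => ((T / B T - K : ℕ) : ℝ) * ((B T - K : ℕ) : ℝ) / T) atTop (nhds 1) := by
  -- This product equals `(T / B - 1 - K) (B - K) / T` with real division; the `-1` pays for
  -- rounding `T / B` down.
  have hlow : Tendsto (fun T : ℕ => (1 - (K : ℝ) * (B T : ℝ)⁻¹) * (1 - (K + 1) * ((B T : ℝ) / T)))
      atTop (nhds 1) := by
    have := ((hB.tendsto_inv.const_mul (K : ℝ)).const_sub 1).mul
      ((hB.tendsto_div.const_mul ((K : ℝ) + 1)).const_sub 1)
    simpa using this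
  refine tendsto_of_tendsto_of_tendsto_of_le_of_le' hlow tendsto_const_nhds ?_ ?_
  · filter_upwards [hB.eventually_lt K, eventually_gt_atTop 0] with T hT hT0
    have hT0' : (0 : ℝ) < T := by exact_mod_cast hT0
    have hB0 : (0 : ℝ) < B T := by exact_mod_cast (Nat.zero_le K).trans_lt hT.1
    have hn : (T : ℝ) / B T - 1 ≤ ((T / B T : ℕ) : ℝ) := by
      rw [sub_le_iff_le_add, div_le_iff₀ hB0]
      have := Nat.div_add_mod T (B T)
      have h2 := (Nat.mod_lt T ((Nat.zero_le K).trans_lt hT.1)).le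
      have h3 : T ≤ (T / B T + 1) * B T := by nlinarith
      exact_mod_cast h3
    rw [Nat.cast_sub hT.1.le, Nat.cast_sub hT.2.le]
    have hBK : (0 : ℝ) ≤ (B T : ℝ) - K := by
      rw [sub_nonneg]; exact_mod_cast hT.1.le
    calc (1 - (K : ℝ) * (B T : ℝ)⁻¹) * (1 - (K + 1) * ((B T : ℝ) / T))
        = ((T : ℝ) / B T - 1 - K) * (B T - K) / T := by field_simp; ring
      _ ≤ _ := by gcongr
  · filter_upwards [eventually_gt_atTop 0] with T hT0
    have hT0' : (0 : ℝ) < T := by exact_mod_cast hT0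
    rw [div_le_one hT0']
    have h1 : (T / B T - K) * (B T - K) ≤ T :=
      (Nat.mul_le_mul (Nat.sub_le _ _) (Nat.sub_le _ _)).trans (Nat.div_mul_le_self T (B T))
    exact_mod_cast h1

/-- Subexponential factors of the error bound are absorbed into `f`, since only its limit enters. -/
lemma Algorithm.le_exponent {A : Algorithm K} {P : Fin K → ℝ} {f : ℕ → ℝ} {L : ℝ}
    (hf : Tendsto f atTop (nhds L))
    (h : ∀ᶠ T : ℕ in atTop, A.poe P T ≤ ENNReal.ofReal (Real.exp (-(T * f T)))) :
    ENNReal.ofReal L ≤ A.exponent P := by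
  have hlim := (ENNReal.continuous_ofReal.tendsto L).comp hf
  rw [← hlim.liminf_eq]
  refine liminf_le_liminf ?_
  filter_upwards [h, eventually_gt_atTop 0] with T hT hT0
  have hT0' : (0 : ℝ) < T := by exact_mod_cast hT0
  have h1 : ENNReal.ofReal (Real.exp (T * f T)) ≤ (A.poe P T)⁻¹ := by
    rw [ENNReal.le_inv_iff_le_inv, ← ENNReal.ofReal_inv_of_pos (Real.exp_pos _), ← Real.exp_neg]
    exact hT
  have h2 : ENNReal.ofReal (T * f T) ≤ (ENNReal.log (A.poe P T)⁻¹).toENNReal := by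
    have := EReal.toENNReal_le_toENNReal (ENNReal.log_monotone h1)
    rwa [ENNReal.log_ofReal_of_pos (Real.exp_pos _), Real.log_exp, EReal.toENNReal_of_ne_top (EReal.coe_ne_top _), EReal.toReal_coe] at this
  rw [ENNReal.le_div_iff_mul_le (Or.inl (by exact_mod_cast hT0.ne')) (Or.inl (by simp))]
  refine le_trans (le_of_eq ?_) h2
  rw [Function.comp, mul_comm, ENNReal.ofReal_mul hT0'.le, ENNReal.ofReal_natCast]

/-- Budgets along a subsequence suffice, because the exponent is a lower limit. -/
lemma Algorithm.exponent_le {A : Algorithm K} {P : Fin K → ℝ} {ψ : ℕ → ℕ}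
    (hψ : Tendsto ψ atTop atTop) {f : ℕ → ℝ} {L : ℝ} (hf : Tendsto f atTop (nhds L))
    (h : ∀ᶠ k : ℕ in atTop, ENNReal.ofReal (Real.exp (-(ψ k * f k))) ≤ A.poe P (ψ k)) :
    A.exponent P ≤ ENNReal.ofReal L := by
  have hlim := (ENNReal.continuous_ofReal.tendsto L).comp hf
  rw [← hlim.liminf_eq]
  refine le_trans (hψ.liminf_le_liminf_comp) ?_
  refine liminf_le_liminf ?_
  filter_upwards [h, hψ.eventually_gt_atTop 0] with k hT hT0
  have hT0' : (0 : ℝ) < ψ k := by exact_mod_cast hT0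
  have h1 : (A.poe P (ψ k))⁻¹ ≤ ENNReal.ofReal (Real.exp (ψ k * f k)) := by
    rw [ENNReal.inv_le_iff_inv_le, ← ENNReal.ofReal_inv_of_pos (Real.exp_pos _), ← Real.exp_neg]
    exact hT
  have h2 : (ENNReal.log (A.poe P (ψ k))⁻¹).toENNReal ≤ ENNReal.ofReal (ψ k * f k) := by
    have := EReal.toENNReal_le_toENNReal (ENNReal.log_monotone h1)
    rwa [ENNReal.log_ofReal_of_pos (Real.exp_pos _), Real.log_exp, EReal.toENNReal_of_ne_top (EReal.coe_ne_top _), EReal.toReal_coe] at this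
  refine ENNReal.div_le_of_le_mul (h2.trans (le_of_eq ?_))
  rw [Function.comp, mul_comm, ENNReal.ofReal_mul' hT0'.le, ENNReal.ofReal_natCast]

/-- The votes use only the rewards of the first `B T * (T / B T) ≤ T` rounds, so the extension by
zero is never seen. -/
lemma recommend_pooledAllocation [NeZero K] {w : Allocation K} (hw : Measurable w) (B : ℕ → ℕ)
    {T : ℕ} (hn : K ≤ T / B T) (x : ℕ → ℝ) :
    (pooledAllocation w hw B).recommend T (fun t : Fin T => x t) =
      argmax (victories w (B T) (T / B T) x) := by
  change argmax (victories w (B T) (T / B T) (extend _)) = _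
  rw [victories_congr hn fun k hk => ?_]
  rw [extend, dif_pos (hk.trans_le ?_)]
  rw [mul_comm]
  exact Nat.div_mul_le_self T (B T)

/-- The error of Pooled Allocation forces a large energy of the noise. -/
lemma poe_pooledAllocation_le [NeZero K] {w : Allocation K} (hw : Measurable w) {B : ℕ → ℕ}
    {P : Fin K → ℝ} {i : Fin K} (hi : IsBest P i) {c : ℝ} (hc : 0 ≤ c)
    (hcost : ∀ Q, ¬ IsBest Q i → c ≤ ∑ j, (w Q : Fin K → ℝ) j * ((Q j - P j) ^ 2 / 2))
    {a : ℝ} (ha : 0 ≤ a) {T : ℕ} (hn : K < T / B T) :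
    (pooledAllocation w hw B).poe P T ≤
      ENNReal.ofReal (Real.exp (-(a * (((T / B T - K : ℕ) : ℝ) * ((B T - K : ℕ) : ℝ) * (c / 2))))) *
        squareMoment a ^ (K * (B T - K + 1)) := by
  have hproc := isPooledProcess_reward w hw B P hn
  refine le_trans ?_ (hproc.measure_le_energy ha (B T - K) _)
  have hne : ∀ᵐ z ∂noiseLaw, ∀ m, ∀ j k, j ≠ k →
      pool w (T / B T) ((pooledAllocation w hw B).reward T P z) m j ≠
        pool w (T / B T) ((pooledAllocation w hw B).reward T P z) m k := by
    rw [ae_all_iff]; intro m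
    rw [ae_all_iff]; intro j
    rw [ae_all_iff]; intro k
    by_cases hjk : j = k
    · simp [hjk]
    · filter_upwards [hproc.pool_ne_ae hjk m] with z hz _ using hz
  refine measure_mono_ae ?_
  filter_upwards [hne] with z hz herr
  refine (hproc.run z).le_energy_of_error hn hc hcost hz ?_
  rintro heq
  refine herr ?_
  rw [recommend_pooledAllocation hw B hn.le, heq]
  exact hi

/-- The exponent of Pooled Allocation is at least half of the worst sampling cost. -/
lemma le_exponent_pooledAllocation [NeZero K] {w : Allocation K} (hw : Measurable w) {B : ℕ → ℕ}
    (hB : IsBatchSchedule B) {P : Fin K → ℝ} {i : Fin K} (hi : IsBest P i) {c : ℝ} (hc : 0 ≤ c)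
    (hcost : ∀ Q, ¬ IsBest Q i → c ≤ ∑ j, (w Q : Fin K → ℝ) j * ((Q j - P j) ^ 2 / 2)) :
    ENNReal.ofReal (c / 2) ≤ (pooledAllocation w hw B).exponent P := by
  -- The exponential moment is finite for `a < 1`; the full constant `c / 2` comes from letting `a`
  -- tend to `1` afterwards.
  have key : ∀ a : ℝ, 0 ≤ a → a < 1 →
      ENNReal.ofReal (a * (c / 2)) ≤ (pooledAllocation w hw B).exponent P := by
    intro a ha ha1
    set S := (squareMoment a).toReal with hS
    have hS1 : 1 ≤ S := by
      rw [hS, ← ENNReal.toReal_one]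
      exact ENNReal.toReal_mono (squareMoment_lt_top ha1).ne (one_le_squareMoment ha)
    have hSeq : squareMoment a = ENNReal.ofReal (Real.exp (Real.log S)) := by
      rw [Real.exp_log (by linarith), hS, ENNReal.ofReal_toReal (squareMoment_lt_top ha1).ne]
    refine Algorithm.le_exponent (f := fun T : ℕ =>
      a * (c / 2) * (((T / B T - K : ℕ) : ℝ) * ((B T - K : ℕ) : ℝ) / T) -
        K * Real.log S * ((B T : ℝ) / T)) ?_ ?_
    · have := ((hB.tendsto_rounds K).const_mul (a * (c / 2))).sub
        (hB.tendsto_div.const_mul (K * Real.log S))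
      simpa using this
    · filter_upwards [hB.eventually_lt K, eventually_gt_atTop 0] with T hT hT0
      have hT0' : (0 : ℝ) < T := by exact_mod_cast hT0
      refine (poe_pooledAllocation_le hw hi hc hcost ha hT.2).trans ?_
      rw [hSeq, ← ENNReal.ofReal_pow (Real.exp_pos _).le, ← Real.exp_nat_mul,
        ← ENNReal.ofReal_mul (Real.exp_pos _).le, ← Real.exp_add]
      refine ENNReal.ofReal_le_ofReal (Real.exp_le_exp.2 ?_)
      -- The number of moment factors is at most `K B`, because `1 ≤ K < B`; this makes their
      -- logarithm `o(T)`.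
      have hle : ((K * (B T - K + 1) : ℕ) : ℝ) ≤ K * B T := by
        have : 0 < K := NeZero.pos K
        exact_mod_cast Nat.mul_le_mul_left K (by omega : B T - K + 1 ≤ B T)
      have hlog := mul_le_mul_of_nonneg_right hle (Real.log_nonneg hS1)
      have e : (T : ℝ) * (a * (c / 2) * (((T / B T - K : ℕ) : ℝ) * ((B T - K : ℕ) : ℝ) / T) -
          K * Real.log S * ((B T : ℝ) / T)) =
          a * (((T / B T - K : ℕ) : ℝ) * ((B T - K : ℕ) : ℝ) * (c / 2)) -
            K * B T * Real.log S := by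
        field_simp
      rw [e]
      linarith
  have hlim : Tendsto (fun k : ℕ => ENNReal.ofReal ((1 - 1 / ((k : ℝ) + 1)) * (c / 2))) atTop
      (nhds (ENNReal.ofReal (c / 2))) := by
    refine (ENNReal.continuous_ofReal.tendsto _).comp ?_
    simpa using (tendsto_one_div_add_atTop_nhds_zero_nat.const_sub (1 : ℝ)).mul_const (c / 2)
  refine le_of_tendsto' hlim fun k => key _ ?_ ?_
  · rw [sub_nonneg, div_le_one (by positivity)]
    linarith [(Nat.cast_nonneg k : (0 : ℝ) ≤ k)]
  · linarith [(Nat.one_div_pos_of_nat : 0 < 1 / ((k : ℝ) + 1))]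

/-- The rate of Pooled Allocation is at least half of the value of its allocation function. -/
theorem half_gameValue_le_rate [NeZero K] {H : (Fin K → ℝ) → ℝ≥0∞}
    (hH : ∀ P, HasUniqueBest P → 0 < H P) {w : Allocation K} (hw : Measurable w) {B : ℕ → ℕ}
    (hB : IsBatchSchedule B) : gameValue H w / 2 ≤ (pooledAllocation w hw B).rate H := by
  refine le_iInf₂ fun P hP => ?_
  by_cases hHP : H P = ⊤
  · simp [riskMul, hHP]
  rw [riskMul, if_neg hHP]
  obtain ⟨i, hi, hiu⟩ := hP
  have hH0 : H P ≠ 0 := (hH P ⟨i, hi, hiu⟩).ne'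
  suffices hs : gameValue H w / H P / 2 ≤ (pooledAllocation w hw B).exponent P by
    calc gameValue H w / 2 = H P * (gameValue H w / H P / 2) := by
          rw [← mul_div_assoc, ENNReal.mul_div_cancel hH0 hHP]
      _ ≤ _ := by gcongr
  -- The quotient can be infinite, for instance when `K = 1` and nothing is misled, so it is
  -- approached by finite costs `r`.
  refine ENNReal.div_le_of_le_mul (ENNReal.le_of_forall_nnreal_lt fun r hr => ?_)
  have hcost : ∀ Q, ¬ IsBest Q i →
      (r : ℝ) ≤ ∑ j, (w Q : Fin K → ℝ) j * ((Q j - P j) ^ 2 / 2) := by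
    intro Q hQ
    have hloss := le_gameValue_iff.1 (le_refl (gameValue H w)) P Q
      ⟨⟨i, hi, hiu⟩, fun j hj => by rwa [hiu j hj]⟩
    rw [proportionLoss, riskMul, if_neg hHP] at hloss
    have h2 : (r : ℝ≥0∞) ≤
        ∑ j, ENNReal.ofReal ((w Q : Fin K → ℝ) j) * gaussKL (Q j) (P j) := by
      refine hr.le.trans (ENNReal.div_le_of_le_mul ?_)
      rwa [mul_comm]
    rw [sum_mul_gaussKL, ← ENNReal.ofReal_coe_nnreal] at h2
    exact (ENNReal.ofReal_le_ofReal_iff (Finset.sum_nonneg fun j _ =>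
      mul_nonneg (simplex_nonneg (w Q) j) (by positivity))).1 h2
  have := le_exponent_pooledAllocation hw hB hi r.2 hcost
  calc (r : ℝ≥0∞) = ENNReal.ofReal ((r : ℝ) / 2) * 2 := by
        rw [← ENNReal.ofReal_ofNat, ← ENNReal.ofReal_mul (by positivity), ← ENNReal.ofReal_coe_nnreal]
        congr 1
        ring
    _ ≤ _ := mul_le_mul_left this 2

/-! ### Change of measure -/

/-- The arm sampled in round `t` when the rewards are `x`. -/
def Algorithm.arm (A : Algorithm K) (T : ℕ) (x : ℕ → ℝ) (t : ℕ) : Fin K :=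
  A.sample T t fun s : Fin t => x s

lemma Algorithm.measurable_arm (A : Algorithm K) (T t : ℕ) : Measurable fun x => A.arm T x t :=
  (A.measurable_sample T t).comp (measurable_pi_lambda _ fun _ => measurable_pi_apply _)

lemma Algorithm.arm_dependsOnlyOn (A : Algorithm K) (T t : ℕ) :
    DependsOnlyOn (fun x => A.arm T x t) (Set.Iio t) := by
  intro x y h
  have : (fun s : Fin t => x s) = fun s : Fin t => y s := funext fun s => h s (Set.mem_Iio.2 s.2)
  simp only [arm, this]

lemma Algorithm.reward_eq_arm (A : Algorithm K) (T : ℕ) (P : Fin K → ℝ) (z : ℕ → ℝ) (t : ℕ) :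
    A.reward T P z t = P (A.arm T (A.reward T P z) t) + z t := A.reward_eq T P z t

lemma DependsOnlyOn.comp_reward {β : Type*} {f : (ℕ → ℝ) → β} {N : ℕ}
    (hf : DependsOnlyOn f (Set.Iio N)) (A : Algorithm K) (T : ℕ) (P : Fin K → ℝ) :
    DependsOnlyOn (fun z => f (A.reward T P z)) (Set.Iio N) := fun z z' h =>
  hf _ _ fun k hk => A.reward_dependsOnlyOn T P k z z' fun j hj =>
    h j (Set.mem_Iio.2 ((Set.mem_Iic.1 hj).trans_lt (Set.mem_Iio.1 hk)))

/-- The log-likelihood ratio of the instances `Q` and `P` after `N` rounds, under `Q`. -/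
def Algorithm.logRatio (A : Algorithm K) (T : ℕ) (P Q : Fin K → ℝ) (N : ℕ) (z : ℕ → ℝ) : ℝ :=
  ∑ t ∈ Finset.range N,
    ((Q (A.arm T (A.reward T Q z) t) - P (A.arm T (A.reward T Q z) t)) * z t +
      (Q (A.arm T (A.reward T Q z) t) - P (A.arm T (A.reward T Q z) t)) ^ 2 / 2)

lemma Algorithm.measurable_comp_arm (A : Algorithm K) (T : ℕ) (Q : Fin K → ℝ) (t : ℕ)
    (g : Fin K → ℝ) : Measurable fun z => g (A.arm T (A.reward T Q z) t) :=
  (Measurable.of_discrete (f := g)).comp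
    ((A.measurable_arm T t).comp (A.measurable_reward_seq T Q))

lemma Algorithm.measurable_logRatio (A : Algorithm K) (T : ℕ) (P Q : Fin K → ℝ) (N : ℕ) :
    Measurable (A.logRatio T P Q N) := by
  refine Finset.measurable_sum _ fun t _ => ?_
  have h := A.measurable_comp_arm T Q t fun i => Q i - P i
  exact (h.mul (measurable_pi_apply t)).add ((h.pow_const 2).div_const 2)

lemma Algorithm.logRatio_dependsOnlyOn (A : Algorithm K) (T : ℕ) (P Q : Fin K → ℝ) (N : ℕ) :
    DependsOnlyOn (A.logRatio T P Q N) (Set.Iio N) := by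
  intro z z' h
  refine Finset.sum_congr rfl fun t ht => ?_
  have ht' := Finset.mem_range.1 ht
  have h1 : A.arm T (A.reward T Q z) t = A.arm T (A.reward T Q z') t :=
    (A.arm_dependsOnlyOn T t).comp_reward A T Q z z' fun k hk =>
      h k (Set.mem_Iio.2 ((Set.mem_Iio.1 hk).trans ht'))
  rw [h1, h t (Set.mem_Iio.2 ht')]

lemma measurable_update_pair (N : ℕ) :
    Measurable fun q : (ℕ → ℝ) × ℝ => Function.update q.1 N q.2 := by
  refine measurable_pi_lambda _ fun k => ?_
  by_cases hk : k = N
  · subst hk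
    simpa using measurable_snd
  · simp only [Function.update_of_ne hk]
    exact (measurable_pi_apply k).comp measurable_fst

/-- Change of measure between two instances. -/
lemma Algorithm.lintegral_reward_eq (A : Algorithm K) (T : ℕ) (P Q : Fin K → ℝ) (N : ℕ) :
    ∀ f : (ℕ → ℝ) → ℝ≥0∞, Measurable f → DependsOnlyOn f (Set.Iio N) →
      ∫⁻ z, f (A.reward T P z) ∂noiseLaw =
        ∫⁻ z, f (A.reward T Q z) * ENNReal.ofReal (Real.exp (-A.logRatio T P Q N z))
          ∂noiseLaw := by
  induction N with
  | zero =>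
    intro f _ hf0
    refine lintegral_congr fun z => ?_
    rw [hf0 (A.reward T P z) (A.reward T Q z) fun k hk => absurd hk (by simp)]
    simp [logRatio]
  | succ N ih =>
    intro f hf hfN
    have hS : Disjoint (Finset.range N) {N} := by simp
    have hupd : ∀ R : Fin K → ℝ, ∀ z, Function.update (A.reward T R z) N
        (R (A.arm T (A.reward T R z) N) + z N) = A.reward T R z := by
      intro R z
      rw [← A.reward_eq_arm, Function.update_eq_self]
    have hlocal : ∀ r, DependsOnlyOn (fun x => f (Function.update x N r)) (Set.Iio N) := by
      intro r x y h
      refine hfN _ _ fun k hk => ?_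
      by_cases hkN : k = N
      · simp [hkN]
      · rw [Function.update_of_ne hkN, Function.update_of_ne hkN]
        exact h k (Set.mem_Iio.2 (by have := Set.mem_Iio.1 hk; omega))
    -- one round, started from the rewards `x` of the previous rounds
    let Φ : (Fin K → ℝ) → (ℕ → ℝ) → ℝ → ℝ≥0∞ := fun R x u =>
      f (Function.update x N (R (A.arm T x N) + u))
    let e : (ℕ → ℝ) → ℝ → ℝ≥0∞ := fun x u => ENNReal.ofReal (Real.exp
      (-((Q (A.arm T x N) - P (A.arm T x N)) * u + (Q (A.arm T x N) - P (A.arm T x N)) ^ 2 / 2)))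
    let Ψ : (ℕ → ℝ) → ℝ≥0∞ := fun x => ∫⁻ u, Φ Q x u * e x u ∂gaussianReal 0 1
    have harm : ∀ g : Fin K → ℝ, Measurable fun x => g (A.arm T x N) := fun g =>
      (Measurable.of_discrete (f := g)).comp (A.measurable_arm T N)
    have hΦ : ∀ R, Measurable (Function.uncurry (Φ R)) := by
      intro R
      refine hf.comp ((measurable_update_pair N).comp (measurable_fst.prodMk ?_))
      exact ((harm R).comp measurable_fst).add measurable_snd
    have he : Measurable (Function.uncurry e) := by
      have h1 : Measurable fun q : (ℕ → ℝ) × ℝ => Q (A.arm T q.1 N) - P (A.arm T q.1 N) :=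
        (harm fun i => Q i - P i).comp measurable_fst
      exact (((h1.mul measurable_snd).add ((h1.pow_const 2).div_const 2)).neg).exp.ennreal_ofReal
    have hΦloc : ∀ R u, DependsOnlyOn (fun x => Φ R x u) (Set.Iio N) := by
      intro R u x y h
      have := A.arm_dependsOnlyOn T N x y h
      simp only [Φ] at this ⊢
      rw [this]
      exact hlocal _ x y h
    have heloc : ∀ u, DependsOnlyOn (fun x => e x u) (Set.Iio N) := by
      intro u x y h
      have := A.arm_dependsOnlyOn T N x y h
      simp only [e] at this ⊢
      rw [this]
    have hΨ : Measurable Ψ := ((hΦ Q).mul he).lintegral_prod_right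
    have hΨloc : DependsOnlyOn Ψ (Set.Iio N) := fun x y h =>
      lintegral_congr fun u => congrArg₂ (· * ·) (hΦloc Q u x y h) (heloc u x y h)
    have heval : ∀ g : ℝ → ℝ≥0∞, Measurable g →
        ∫⁻ y, g (y N) ∂noiseLaw = ∫⁻ u, g u ∂gaussianReal 0 1 := fun g hg => by
      rw [← map_eval_noiseLaw N, lintegral_map hg (measurable_pi_apply N)]
    have hx : ∀ R, Measurable fun q : (ℕ → ℝ) × (ℕ → ℝ) => (A.reward T R q.1, q.2 N) := fun R =>
      ((A.measurable_reward_seq T R).comp measurable_fst).prodMk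
        ((measurable_pi_apply N).comp measurable_snd)
    -- Given the first `N` rewards the next arm is fixed, so round `N` reduces to the
    -- one-dimensional shift; `Ψ` is the resulting function of the earlier rewards, to which the
    -- induction hypothesis applies.
    have hP : ∫⁻ z, f (A.reward T P z) ∂noiseLaw = ∫⁻ z, Ψ (A.reward T P z) ∂noiseLaw := by
      have h1 : ∀ z, f (A.reward T P z) = Φ P (A.reward T P z) (z N) := fun z => by
        simp only [Φ, hupd]
      simp_rw [h1]
      rw [lintegral_noise_diag (f := fun z y => Φ P (A.reward T P z) (y N)) hS
        ((hΦ P).comp (hx P))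
        (fun y z z' h => (hΦloc P (y N)).comp_reward A T P z z' fun k hk => h k (by simpa using hk))
        (fun z y y' h => by simp only [h N (by simp)])]
      refine lintegral_congr fun z => ?_
      have hm : ∀ R, Measurable (Φ R (A.reward T P z)) := fun R =>
        (hΦ R).comp measurable_prodMk_left
      rw [heval _ (hm P)]
      exact lintegral_gaussian_shift (g := fun r => f (Function.update (A.reward T P z) N r))
        (hf.comp ((measurable_update_pair N).comp measurable_prodMk_left)) _ _
    rw [hP, ih Ψ hΨ hΨloc]
    have h2 : ∀ z, f (A.reward T Q z) *
        ENNReal.ofReal (Real.exp (-A.logRatio T P Q (N + 1) z)) =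
        ENNReal.ofReal (Real.exp (-A.logRatio T P Q N z)) *
          (Φ Q (A.reward T Q z) (z N) * e (A.reward T Q z) (z N)) := by
      intro z
      have h3 : A.logRatio T P Q (N + 1) z = A.logRatio T P Q N z + _ :=
        Finset.sum_range_succ _ _
      rw [h3, neg_add, Real.exp_add, ENNReal.ofReal_mul (Real.exp_pos _).le]
      simp only [Φ, hupd, e]
      ring
    simp_rw [h2]
    have hE : Measurable fun z => ENNReal.ofReal (Real.exp (-A.logRatio T P Q N z)) :=
      (A.measurable_logRatio T P Q N).neg.exp.ennreal_ofReal
    have hm : Measurable fun q : (ℕ → ℝ) × (ℕ → ℝ) =>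
        Φ Q (A.reward T Q q.1) (q.2 N) * e (A.reward T Q q.1) (q.2 N) :=
      ((hΦ Q).mul he).comp (hx Q)
    rw [lintegral_noise_diag (f := fun z y => ENNReal.ofReal (Real.exp (-A.logRatio T P Q N z)) *
      (Φ Q (A.reward T Q z) (y N) * e (A.reward T Q z) (y N))) hS
      ((hE.comp measurable_fst).mul hm) ?_ ?_]
    · refine lintegral_congr fun z => ?_
      have hmz : Measurable fun u => Φ Q (A.reward T Q z) u * e (A.reward T Q z) u :=
        ((hΦ Q).mul he).comp measurable_prodMk_left
      have hmy : Measurable fun y : ℕ → ℝ =>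
          Φ Q (A.reward T Q z) (y N) * e (A.reward T Q z) (y N) :=
        hmz.comp (measurable_pi_apply N)
      rw [lintegral_const_mul _ hmy, heval _ hmz, mul_comm]
    · intro y z z' h
      have h' : ∀ k ∈ Set.Iio N, z k = z' k := fun k hk => h k (by simpa using hk)
      have e1 := A.logRatio_dependsOnlyOn T P Q N z z' h'
      have e2 := (hΦloc Q (y N)).comp_reward A T Q z z' h'
      have e3 := (heloc (y N)).comp_reward A T Q z z' h'
      simp only at e2 e3 ⊢
      rw [e1, e2, e3]
    · intro z y y' h
      simp only [h N (by simp)]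

/-! ### The transport inequality -/

/-- The martingale part of the log-likelihood ratio. -/
def Algorithm.noisePart (A : Algorithm K) (T : ℕ) (P Q : Fin K → ℝ) (N : ℕ) (z : ℕ → ℝ) : ℝ :=
  ∑ t ∈ Finset.range N,
    (Q (A.arm T (A.reward T Q z) t) - P (A.arm T (A.reward T Q z) t)) * z t

/-- The sum of the Kullback–Leibler divergences of the sampled arms. -/
def Algorithm.divergence (A : Algorithm K) (T : ℕ) (P Q : Fin K → ℝ) (N : ℕ) (z : ℕ → ℝ) : ℝ :=
  ∑ t ∈ Finset.range N,
    (Q (A.arm T (A.reward T Q z) t) - P (A.arm T (A.reward T Q z) t)) ^ 2 / 2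

lemma Algorithm.logRatio_eq (A : Algorithm K) (T : ℕ) (P Q : Fin K → ℝ) (N : ℕ) (z : ℕ → ℝ) :
    A.logRatio T P Q N z = A.noisePart T P Q N z + A.divergence T P Q N z :=
  Finset.sum_add_distrib

lemma Algorithm.measurable_noisePart (A : Algorithm K) (T : ℕ) (P Q : Fin K → ℝ) (N : ℕ) :
    Measurable (A.noisePart T P Q N) :=
  Finset.measurable_sum _ fun t _ =>
    (A.measurable_comp_arm T Q t fun i => Q i - P i).mul (measurable_pi_apply t)

lemma Algorithm.measurable_divergence (A : Algorithm K) (T : ℕ) (P Q : Fin K → ℝ) (N : ℕ) :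
    Measurable (A.divergence T P Q N) :=
  Finset.measurable_sum _ fun t _ =>
    ((A.measurable_comp_arm T Q t fun i => Q i - P i).pow_const 2).div_const 2

/-- The squared Euclidean distance of two instances. -/
def sqDist (P Q : Fin K → ℝ) : ℝ := ∑ i, (Q i - P i) ^ 2

lemma sq_sub_le_sqDist (P Q : Fin K → ℝ) (i : Fin K) : (Q i - P i) ^ 2 ≤ sqDist P Q :=
  Finset.single_le_sum (f := fun i => (Q i - P i) ^ 2) (fun _ _ => sq_nonneg _) (Finset.mem_univ i)

lemma Algorithm.divergence_nonneg (A : Algorithm K) (T : ℕ) (P Q : Fin K → ℝ) (N : ℕ)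
    (z : ℕ → ℝ) : 0 ≤ A.divergence T P Q N z := Finset.sum_nonneg fun _ _ => by positivity

lemma Algorithm.divergence_le (A : Algorithm K) (T : ℕ) (P Q : Fin K → ℝ) (N : ℕ) (z : ℕ → ℝ) :
    A.divergence T P Q N z ≤ N * (sqDist P Q / 2) := by
  calc A.divergence T P Q N z ≤ ∑ _t ∈ Finset.range N, sqDist P Q / 2 :=
        Finset.sum_le_sum fun t _ => by
          have := sq_sub_le_sqDist P Q (A.arm T (A.reward T Q z) t)
          linarith
    _ = _ := by simp

lemma integrable_noise (t : ℕ) : Integrable (fun z : ℕ → ℝ => z t) noiseLaw := by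
  have h : Integrable (fun x : ℝ => x) (noiseLaw.map fun z => z t) := by
    rw [map_eval_noiseLaw]
    exact (memLp_id_gaussianReal 1).integrable le_rfl
  exact h.comp_measurable (measurable_pi_apply t)

lemma Algorithm.integrable_noisePart (A : Algorithm K) (T : ℕ) (P Q : Fin K → ℝ) (N : ℕ) :
    Integrable (A.noisePart T P Q N) noiseLaw := by
  refine integrable_finsetSum _ fun t _ => ?_
  refine (integrable_noise t).bdd_mul (c := √(sqDist P Q))
    (A.measurable_comp_arm T Q t fun i => Q i - P i).aestronglyMeasurable
    (Eventually.of_forall fun z => ?_)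
  exact Real.abs_le_sqrt (sq_sub_le_sqDist P Q _)

lemma Algorithm.integrable_divergence (A : Algorithm K) (T : ℕ) (P Q : Fin K → ℝ) (N : ℕ) :
    Integrable (A.divergence T P Q N) noiseLaw :=
  Integrable.of_bound (A.measurable_divergence T P Q N).aestronglyMeasurable
    (N * (sqDist P Q / 2)) (Eventually.of_forall fun z => by
      rw [Real.norm_of_nonneg (A.divergence_nonneg T P Q N z)]
      exact A.divergence_le T P Q N z)

/-- The exponential martingale comes from the change of measure itself. For the auxiliary instance
`R = Q + l (Q - P)` the likelihood ratio is `exp (l * noisePart - l² * divergence)`, which has total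
mass one, and the divergence has a deterministic bound. -/
lemma Algorithm.lintegral_exp_noisePart_le (A : Algorithm K) (T : ℕ) (P Q : Fin K → ℝ) (N : ℕ)
    (l : ℝ) : ∫⁻ z, ENNReal.ofReal (Real.exp (l * A.noisePart T P Q N z)) ∂noiseLaw ≤
      ENNReal.ofReal (Real.exp (l ^ 2 * (N * (sqDist P Q / 2)))) := by
  set R : Fin K → ℝ := fun i => Q i + l * (Q i - P i) with hR
  have hratio : ∀ z, -A.logRatio T R Q N z =
      l * A.noisePart T P Q N z - l ^ 2 * A.divergence T P Q N z := by
    intro z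
    simp only [logRatio, noisePart, divergence, Finset.mul_sum, ← Finset.sum_sub_distrib,
      ← Finset.sum_neg_distrib, hR]
    refine Finset.sum_congr rfl fun t _ => ?_
    ring
  have h1 := A.lintegral_reward_eq T R Q N (fun _ => 1) measurable_const fun _ _ _ => rfl
  simp only [lintegral_const, measure_univ, one_mul, hratio] at h1
  calc ∫⁻ z, ENNReal.ofReal (Real.exp (l * A.noisePart T P Q N z)) ∂noiseLaw
      ≤ ∫⁻ z, ENNReal.ofReal (Real.exp (l * A.noisePart T P Q N z -
          l ^ 2 * A.divergence T P Q N z)) *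
            ENNReal.ofReal (Real.exp (l ^ 2 * (N * (sqDist P Q / 2)))) ∂noiseLaw := by
        refine lintegral_mono fun z => ?_
        rw [← ENNReal.ofReal_mul (Real.exp_pos _).le, ← Real.exp_add]
        refine ENNReal.ofReal_le_ofReal (Real.exp_le_exp.2 ?_)
        have := mul_le_mul_of_nonneg_left (A.divergence_le T P Q N z) (sq_nonneg l)
        linarith
    _ = _ := by
        have hm : Measurable fun z => ENNReal.ofReal (Real.exp (l * A.noisePart T P Q N z -
            l ^ 2 * A.divergence T P Q N z)) :=
          (((A.measurable_noisePart T P Q N).const_mul l).sub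
            ((A.measurable_divergence T P Q N).const_mul (l ^ 2))).exp.ennreal_ofReal
        rw [lintegral_mul_const _ hm, ← h1, one_mul]

/-- The martingale part is of the order of the square root of the number of rounds. -/
lemma Algorithm.setIntegral_noisePart_le (A : Algorithm K) (T : ℕ) (P Q : Fin K → ℝ) {N : ℕ}
    (hN : 0 < N) (E : Set (ℕ → ℝ)) :
    ∫ z in E, A.noisePart T P Q N z ∂noiseLaw ≤ √N * Real.exp (sqDist P Q / 2) := by
  have hN' : (0 : ℝ) < N := by exact_mod_cast hN
  have hs : 0 < √(N : ℝ) := Real.sqrt_pos.2 hN'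
  -- This scale makes the exponential moment bounded independently of `N`; then `x ≤ √N exp (x /
  -- √N)` yields the order `√N`, uniformly over events.
  set l : ℝ := (√(N : ℝ))⁻¹ with hl
  have hl2 : l ^ 2 * (N * (sqDist P Q / 2)) = sqDist P Q / 2 := by
    rw [hl, inv_pow, Real.sq_sqrt hN'.le, ← mul_assoc, inv_mul_cancel₀ hN'.ne', one_mul]
  have hle := A.lintegral_exp_noisePart_le T P Q N l
  rw [hl2] at hle
  have hm : Measurable fun z => Real.exp (l * A.noisePart T P Q N z) :=
    ((A.measurable_noisePart T P Q N).const_mul l).exp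
  have hint : Integrable (fun z => Real.exp (l * A.noisePart T P Q N z)) noiseLaw :=
    ⟨hm.aestronglyMeasurable, (hasFiniteIntegral_iff_ofReal
      (Eventually.of_forall fun z => (Real.exp_pos _).le)).2 (hle.trans_lt ENNReal.ofReal_lt_top)⟩
  have hexp : ∫ z, Real.exp (l * A.noisePart T P Q N z) ∂noiseLaw ≤ Real.exp (sqDist P Q / 2) := by
    rw [integral_eq_lintegral_of_nonneg_ae (Eventually.of_forall fun z => (Real.exp_pos _).le)
      hm.aestronglyMeasurable]
    exact ENNReal.toReal_le_of_le_ofReal (Real.exp_pos _).le hle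
  have hint2 : Integrable (fun z => √N * Real.exp (l * A.noisePart T P Q N z)) noiseLaw :=
    hint.const_mul _
  calc ∫ z in E, A.noisePart T P Q N z ∂noiseLaw
      ≤ ∫ z in E, √N * Real.exp (l * A.noisePart T P Q N z) ∂noiseLaw := by
        refine setIntegral_mono (A.integrable_noisePart T P Q N).integrableOn hint2.integrableOn
          fun z => ?_
        have h1 := Real.add_one_le_exp (l * A.noisePart T P Q N z)
        have h2 : √N * (l * A.noisePart T P Q N z) = A.noisePart T P Q N z := by
          rw [hl, ← mul_assoc, mul_inv_cancel₀ hs.ne', one_mul]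
        calc A.noisePart T P Q N z = √N * (l * A.noisePart T P Q N z) := h2.symm
          _ ≤ √N * Real.exp (l * A.noisePart T P Q N z) := by
            gcongr
            linarith
    _ ≤ ∫ z, √N * Real.exp (l * A.noisePart T P Q N z) ∂noiseLaw :=
        setIntegral_le_integral hint2 (Eventually.of_forall fun z => by positivity)
    _ = √N * ∫ z, Real.exp (l * A.noisePart T P Q N z) ∂noiseLaw := integral_const_mul _ _
    _ ≤ _ := by gcongr

/-- Lower bound for the probability under `P` of an event that is likely under `Q`. -/
lemma Algorithm.transport (A : Algorithm K) (T : ℕ) (P Q : Fin K → ℝ) {N : ℕ} (hN : 0 < N)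
    {E : Set (ℕ → ℝ)} (hE : MeasurableSet E) (hEN : DependsOnlyOn (· ∈ E) (Set.Iio N)) {p D : ℝ}
    (hp : noiseLaw.real {z | A.reward T Q z ∈ E} = p) (hp0 : 0 < p)
    (hD : ∫ z, A.divergence T P Q N z ∂noiseLaw = D) :
    ENNReal.ofReal (p * Real.exp (-((D + √N * Real.exp (sqDist P Q / 2)) / p))) ≤
      noiseLaw {z | A.reward T P z ∈ E} := by
  classical
  set S := D + √N * Real.exp (sqDist P Q / 2) with hS
  -- `c` bounds the conditional mean of the log-likelihood ratio `L` on `F`. Jensen's inequality is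
  -- applied through the tangent `exp (-L) ≥ exp (-c) (1 + c - L)` at `L = c`.
  set c := S / p with hc
  set F := {z | A.reward T Q z ∈ E} with hF
  have hFm : MeasurableSet F := A.measurable_reward_seq T Q hE
  have hL : Integrable (A.logRatio T P Q N) noiseLaw := by
    have : A.logRatio T P Q N = A.noisePart T P Q N + A.divergence T P Q N :=
      funext fun z => A.logRatio_eq T P Q N z
    rw [this]
    exact (A.integrable_noisePart T P Q N).add (A.integrable_divergence T P Q N)
  have hchange : noiseLaw {z | A.reward T P z ∈ E} =
      ∫⁻ z in F, ENNReal.ofReal (Real.exp (-A.logRatio T P Q N z)) ∂noiseLaw := by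
    have h1 := A.lintegral_reward_eq T P Q N (E.indicator 1) (measurable_one.indicator hE) (by
      intro x y h
      have := hEN x y h
      simp only [eq_iff_iff] at this
      by_cases hx : x ∈ E
      · rw [Set.indicator_of_mem hx, Set.indicator_of_mem (this.1 hx)]; rfl
      · rw [Set.indicator_of_notMem hx, Set.indicator_of_notMem fun hy => hx (this.2 hy)])
    have h2 : ∫⁻ z, E.indicator 1 (A.reward T P z) ∂noiseLaw =
        noiseLaw {z | A.reward T P z ∈ E} := by
      rw [← lintegral_map (measurable_one.indicator hE) (A.measurable_reward_seq T P),
        lintegral_indicator_one hE, Measure.map_apply (A.measurable_reward_seq T P) hE]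
      rfl
    rw [← h2, h1, ← lintegral_indicator hFm]
    refine lintegral_congr fun z => ?_
    by_cases hz : A.reward T Q z ∈ E
    · rw [Set.indicator_of_mem hz, Set.indicator_of_mem (show z ∈ F from hz)]
      simp
    · rw [Set.indicator_of_notMem hz, Set.indicator_of_notMem (show z ∉ F from hz)]
      simp
  have hLF : ∫ z in F, A.logRatio T P Q N z ∂noiseLaw ≤ S := by
    simp only [A.logRatio_eq]
    rw [integral_add (A.integrable_noisePart T P Q N).integrableOn
      (A.integrable_divergence T P Q N).integrableOn, hS, add_comm, ← hD]
    refine add_le_add ?_ (A.setIntegral_noisePart_le T P Q hN F)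
    exact setIntegral_le_integral (A.integrable_divergence T P Q N)
      (Eventually.of_forall fun z => A.divergence_nonneg T P Q N z)
  have hint : Integrable (fun z => Real.exp (-c) * (1 + c - A.logRatio T P Q N z))
      (noiseLaw.restrict F) := (((integrable_const _).sub hL).const_mul _).integrableOn
  have hlow : p * Real.exp (-c) ≤
      ∫ z in F, Real.exp (-c) * (1 + c - A.logRatio T P Q N z) ∂noiseLaw := by
    rw [integral_const_mul, integral_sub (integrable_const _) hL.integrableOn, setIntegral_const,
      hp, smul_eq_mul]
    have : c * p = S := div_mul_cancel₀ S hp0.ne'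
    rw [mul_comm]
    gcongr
    linarith
  rw [hchange]
  calc ENNReal.ofReal (p * Real.exp (-c))
      -- The tangent can be negative, so its positive part is taken before passing to the
      -- nonnegative integral.
      ≤ ENNReal.ofReal (∫ z in F, max (Real.exp (-c) * (1 + c - A.logRatio T P Q N z)) 0
          ∂noiseLaw) := by
        refine ENNReal.ofReal_le_ofReal (hlow.trans ?_)
        exact integral_mono hint hint.pos_part fun z => le_max_left _ _
    _ = ∫⁻ z in F, ENNReal.ofReal (max (Real.exp (-c) * (1 + c - A.logRatio T P Q N z)) 0)
          ∂noiseLaw :=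
        ofReal_integral_eq_lintegral_ofReal hint.pos_part
          (Eventually.of_forall fun z => le_max_right _ _)
    _ ≤ _ := by
        refine lintegral_mono fun z => ENNReal.ofReal_le_ofReal (max_le ?_ (Real.exp_pos _).le)
        have h1 := Real.add_one_le_exp (c - A.logRatio T P Q N z)
        calc Real.exp (-c) * (1 + c - A.logRatio T P Q N z)
            ≤ Real.exp (-c) * Real.exp (c - A.logRatio T P Q N z) := by
              gcongr
              linarith
          _ = Real.exp (-A.logRatio T P Q N z) := by rw [← Real.exp_add]; ring_nf

/-- The expected number of rounds in which arm `i` is sampled, divided by the budget. -/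
def Algorithm.meanProportion (A : Algorithm K) (Q : Fin K → ℝ) (T : ℕ) (i : Fin K) : ℝ :=
  (∑ t ∈ Finset.range T, noiseLaw.real {z | A.arm T (A.reward T Q z) t = i}) / T

lemma Algorithm.measurableSet_arm_eq (A : Algorithm K) (Q : Fin K → ℝ) (T t : ℕ) (i : Fin K) :
    MeasurableSet {z | A.arm T (A.reward T Q z) t = i} :=
  (A.measurable_arm T t).comp (A.measurable_reward_seq T Q) (measurableSet_singleton i)

lemma Algorithm.meanProportion_mem (A : Algorithm K) (Q : Fin K → ℝ) {T : ℕ} (hT : 0 < T) :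
    A.meanProportion Q T ∈ stdSimplex ℝ (Fin K) := by
  have hT' : (T : ℝ) ≠ 0 := by exact_mod_cast hT.ne'
  refine ⟨fun i => div_nonneg (Finset.sum_nonneg fun t _ => measureReal_nonneg)
    (Nat.cast_nonneg T), ?_⟩
  simp only [meanProportion]
  rw [← Finset.sum_div, Finset.sum_comm, div_eq_one_iff_eq hT']
  have : ∀ t, ∑ i, noiseLaw.real {z | A.arm T (A.reward T Q z) t = i} = 1 := by
    intro t
    have h := sum_measureReal_preimage_singleton (μ := noiseLaw) Finset.univ
      (f := fun z => A.arm T (A.reward T Q z) t) fun i _ => A.measurableSet_arm_eq Q T t i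
    simpa [Set.preimage] using h
  simp [this]

/-- Wald's identity: the divergence of a round depends only on the sampled arm, so expectations see
only the expected sampling counts. -/
lemma Algorithm.integral_divergence (A : Algorithm K) (P Q : Fin K → ℝ) {T : ℕ} (hT : 0 < T) :
    ∫ z, A.divergence T P Q T z ∂noiseLaw =
      T * ∑ i, A.meanProportion Q T i * ((Q i - P i) ^ 2 / 2) := by
  classical
  have hT' : (T : ℝ) ≠ 0 := by exact_mod_cast hT.ne'
  have h1 : ∀ t z, (Q (A.arm T (A.reward T Q z) t) - P (A.arm T (A.reward T Q z) t)) ^ 2 / 2 =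
      ∑ i, {z | A.arm T (A.reward T Q z) t = i}.indicator
        (fun _ => (Q i - P i) ^ 2 / 2) z := by
    intro t z
    rw [Finset.sum_eq_single (A.arm T (A.reward T Q z) t)]
    · rw [Set.indicator_of_mem]
      rfl
    · intro i _ hi
      rw [Set.indicator_of_notMem]
      exact fun h => hi h.symm
    · simp
  have hint : ∀ t i, Integrable ({z | A.arm T (A.reward T Q z) t = i}.indicator
      fun _ => (Q i - P i) ^ 2 / 2) noiseLaw := fun t i =>
    (integrable_const _).indicator (A.measurableSet_arm_eq Q T t i)
  simp only [divergence, h1]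
  rw [integral_finsetSum _ fun t _ => integrable_finsetSum _ fun i _ => hint t i]
  simp_rw [integral_finsetSum _ fun i _ => hint _ i,
    integral_indicator_const _ (A.measurableSet_arm_eq Q T _ _), smul_eq_mul]
  rw [Finset.sum_comm, Finset.mul_sum]
  refine Finset.sum_congr rfl fun i _ => ?_
  rw [← Finset.sum_mul, meanProportion]
  field_simp

/-- If an algorithm identifies the best arm of `Q` with probability tending to one, then its
exponents on the instances misled by `Q` are bounded by a common sampling cost. -/
lemma Algorithm.exists_exponent_le (A : Algorithm K) {Q : Fin K → ℝ} {j : Fin K}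
    (hj : IsBest Q j)
    (hcons : Tendsto (fun T => noiseLaw.real
      {z | A.recommend T (fun t : Fin T => A.reward T Q z t) = j}) atTop (nhds 1)) :
    ∃ v : stdSimplex ℝ (Fin K), ∀ P, Misleads P Q →
      A.exponent P ≤ ∑ i, ENNReal.ofReal ((v : Fin K → ℝ) i) * gaussKL (Q i) (P i) := by
  let u : ℕ → stdSimplex ℝ (Fin K) := fun k =>
    ⟨A.meanProportion Q (k + 1), A.meanProportion_mem Q k.succ_pos⟩
  -- The limit is extracted before `P` is introduced, so one vector of proportions and one sequence
  -- of budgets serve all `P`.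
  obtain ⟨v, -, φ, hφ, hlim⟩ := isCompact_univ.tendsto_subseq fun k => Set.mem_univ (u k)
  refine ⟨v, fun P hP => ?_⟩
  rw [sum_mul_gaussKL]
  have hψ : Tendsto (fun k => φ k + 1) atTop atTop :=
    tendsto_atTop_mono (fun k => Nat.le_succ _) hφ.tendsto_atTop
  have hmean : ∀ i, Tendsto (fun k => A.meanProportion Q (φ k + 1) i) atTop
      (nhds ((v : Fin K → ℝ) i)) := fun i =>
    (((continuous_apply i).comp continuous_subtype_val).tendsto v).comp hlim
  let E : (T : ℕ) → Set (ℕ → ℝ) := fun T => {x | ¬ IsBest P (A.recommend T fun t : Fin T => x t)}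
  have hE : ∀ T, MeasurableSet (E T) := by
    intro T
    have hm : Measurable fun x : ℕ → ℝ => A.recommend T fun t : Fin T => x t :=
      (A.measurable_recommend T).comp (measurable_pi_lambda _ fun t => measurable_pi_apply _)
    exact hm (MeasurableSet.of_discrete (s := {i | ¬ IsBest P i}))
  have hEloc : ∀ T, DependsOnlyOn (· ∈ E T) (Set.Iio T) := by
    intro T x y h
    have : (fun t : Fin T => x t) = fun t : Fin T => y t :=
      funext fun t => h t (Set.mem_Iio.2 t.2)
    simp only [E, Set.mem_ofPred_eq, this]
  set p : ℕ → ℝ := fun T => noiseLaw.real {z | A.reward T Q z ∈ E T} with hp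
  -- Recommending `j`, which is likely under `Q`, is an error under `P`, because `P` is misled by
  -- `Q`.
  have hp1 : Tendsto p atTop (nhds 1) := by
    refine tendsto_of_tendsto_of_tendsto_of_le_of_le hcons tendsto_const_nhds
      (fun T => measureReal_mono fun z hz => ?_) fun T => measureReal_le_one
    have hz' : A.recommend T (fun t : Fin T => A.reward T Q z t) = j := hz
    change ¬ IsBest P _
    rw [hz']
    exact fun hPj => hP.2 j hPj hj
  have hpψ := hp1.comp hψ
  have hTinv : Tendsto (fun k => ((φ k + 1 : ℕ) : ℝ)⁻¹) atTop (nhds 0) :=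
    tendsto_inv_atTop_zero.comp (tendsto_natCast_atTop_atTop.comp hψ)
  have hsqrt : Tendsto (fun k => (√((φ k + 1 : ℕ) : ℝ))⁻¹) atTop (nhds 0) :=
    tendsto_inv_atTop_zero.comp
      (Real.tendsto_sqrt_atTop.comp (tendsto_natCast_atTop_atTop.comp hψ))
  -- The transport bound with `p` written as `exp (log p)` and divided by the budget; `p → 1` and
  -- the `√T` term is negligible.
  refine Algorithm.exponent_le hψ (f := fun k =>
    (∑ i, A.meanProportion Q (φ k + 1) i * ((Q i - P i) ^ 2 / 2) +
      (√((φ k + 1 : ℕ) : ℝ))⁻¹ * Real.exp (sqDist P Q / 2)) / p (φ k + 1) -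
        Real.log (p (φ k + 1)) * ((φ k + 1 : ℕ) : ℝ)⁻¹) ?_ ?_
  · have h1 : Tendsto (fun k => ∑ i, A.meanProportion Q (φ k + 1) i * ((Q i - P i) ^ 2 / 2)) atTop
        (nhds (∑ i, (v : Fin K → ℝ) i * ((Q i - P i) ^ 2 / 2))) :=
      tendsto_finsetSum _ fun i _ => (hmean i).mul_const _
    have h2 := ((h1.add (hsqrt.mul_const (Real.exp (sqDist P Q / 2)))).div hpψ one_ne_zero).sub
      ((hpψ.log one_ne_zero).mul hTinv)
    simpa using h2
  · filter_upwards [hpψ.eventually (lt_mem_nhds one_pos)] with k hk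
    have hk' : 0 < p (φ k + 1) := hk
    set T := φ k + 1
    have hT : 0 < T := Nat.succ_pos _
    have hT' : (0 : ℝ) < T := by exact_mod_cast hT
    have htr := A.transport T P Q hT (hE T) (hEloc T) (p := p T) rfl hk' rfl
    rw [A.integral_divergence P Q hT] at htr
    refine le_trans (le_of_eq ?_) htr
    congr 1
    rw [← Real.exp_log hk', ← Real.exp_add, Real.exp_log hk']
    congr 1
    have hs : (T : ℝ) * (√(T : ℝ))⁻¹ = √(T : ℝ) := by
      rw [← div_eq_mul_inv, Real.div_sqrt]
    have e : (T : ℝ) * ((∑ i, A.meanProportion Q T i * ((Q i - P i) ^ 2 / 2) +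
        (√(T : ℝ))⁻¹ * Real.exp (sqDist P Q / 2)) / p T - Real.log (p T) * (T : ℝ)⁻¹) =
        (T * ∑ i, A.meanProportion Q T i * ((Q i - P i) ^ 2 / 2) +
          (T * (√(T : ℝ))⁻¹) * Real.exp (sqDist P Q / 2)) / p T -
          Real.log (p T) * (T * (T : ℝ)⁻¹) := by ring
    rw [e, hs, mul_inv_cancel₀ hT'.ne']
    ring

/-- The rate of a consistent algorithm is at most the value of the one-shot game. -/
theorem Algorithm.rate_le_Rgo [NeZero K] (A : Algorithm K) (H : (Fin K → ℝ) → ℝ≥0∞)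
    (hcons : ∀ (Q : Fin K → ℝ) (j : Fin K), IsBest Q j → (∀ i, IsBest Q i → i = j) →
      Tendsto (fun T => noiseLaw.real
        {z | A.recommend T (fun t : Fin T => A.reward T Q z t) = j}) atTop (nhds 1)) :
    A.rate H ≤ Rgo H := by
  refine le_Rgo_of_forall_exists (exists_proportions_of_unique fun Q hQ => ?_)
  obtain ⟨j, hj, hju⟩ := hQ
  obtain ⟨v, hv⟩ := A.exists_exponent_le hj (hcons Q j hj hju)
  exact ⟨v, fun P hP => (iInf₂_le P hP.1).trans (riskMul_mono (hv P hP))⟩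

/-! ### Consistency of Pooled Allocation -/

/-- There are finitely many strict inequalities, so every small `γ` works; stated with a filter,
this needs no separate case for a single arm. -/
lemma exists_gap {Q : Fin K → ℝ} {j : Fin K} (hj : IsBest Q j) (hju : ∀ i, IsBest Q i → i = j) :
    ∃ γ > 0, ∀ i, i ≠ j → Q i + γ ≤ Q j := by
  have h : ∀ᶠ γ in nhdsWithin (0 : ℝ) (Set.Ioi 0), ∀ i, i ≠ j → Q i + γ ≤ Q j := by
    refine eventually_all.2 fun i => ?_
    by_cases hij : i = j
    · exact Eventually.of_forall fun _ h => absurd hij h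
    · have hlt : Q i < Q j := lt_of_le_of_ne (hj i) fun heq =>
        hij (hju i fun k => by rw [heq]; exact hj k)
      have := (gt_mem_nhds (show (0 : ℝ) < Q j - Q i by linarith))
      filter_upwards [nhdsWithin_le_nhds this] with γ hγ _
      have : γ < Q j - Q i := hγ
      linarith
  obtain ⟨γ, hγ, h0⟩ := (h.and self_mem_nhdsWithin).exists
  exact ⟨γ, h0, hγ⟩

/-- If the energy of the noise is small, then all votes are for the best arm. -/
lemma IsPooledRun.argmax_victories_eq [NeZero K] {Q : Fin K → ℝ} {w : Allocation K} {n B : ℕ}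
    {x z : ℕ → ℝ} (h : IsPooledRun Q w n x z) (hn : K < n) (hB : K < B) {j : Fin K} {γ : ℝ}
    (hγ : 0 < γ) (hgap : ∀ i, i ≠ j → Q i + γ ≤ Q j)
    (henergy : energy w n x z (B - K) < ((n - K : ℕ) : ℝ) * (γ ^ 2 / 8)) :
    argmax (victories w B n x) = j := by
  have hpos : (0 : ℝ) < ((n - K : ℕ) : ℝ) := by exact_mod_cast Nat.sub_pos_of_lt hn
  -- The threshold is `γ² / 8 = (γ / 2)² / 2`, so no pooled mean moves by half the gap.
  have hclose : ∀ m ≤ B - K, ∀ i, |pool w n x m i - Q i| < γ / 2 := by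
    intro m hm i
    have h1 := h.potential_le_energy hn m
    have h2 : 0 ≤ ∑ m ∈ Finset.range m,
        ∑ i, (w (pool w n x m) : Fin K → ℝ) i * ((pool w n x m i - Q i) ^ 2 / 2) :=
      Finset.sum_nonneg fun m _ => Finset.sum_nonneg fun i _ =>
        mul_nonneg (simplex_nonneg _ i) (by positivity)
    have h3 := energy_mono w n x z hm
    have h4 : (pool w n x m i - Q i) ^ 2 / 2 ≤ ∑ i, (pool w n x m i - Q i) ^ 2 / 2 :=
      Finset.single_le_sum (f := fun i => (pool w n x m i - Q i) ^ 2 / 2)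
        (fun _ _ => by positivity) (Finset.mem_univ i)
    have h5 : ((n - K : ℕ) : ℝ) * ∑ i, (pool w n x m i - Q i) ^ 2 / 2 <
        ((n - K : ℕ) : ℝ) * (γ ^ 2 / 8) := by
      have := mul_nonneg hpos.le h2
      linarith
    have h6 := lt_of_mul_lt_mul_left h5 hpos.le
    refine abs_lt_of_sq_lt_sq ?_ (by positivity)
    nlinarith
  have hvote : ∀ m ≤ B - K, argmax (pool w n x m) = j := by
    intro m hm
    by_contra hne
    have h1 := argmax_spec (pool w n x m) j
    have h2 := abs_lt.1 (hclose m hm j)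
    have h3 := abs_lt.1 (hclose m hm (argmax (pool w n x m)))
    have h4 := hgap _ hne
    linarith [h2.1, h3.2]
  by_contra hne
  have h1 := half_votes_of_argmax_ne hne
  rw [Finset.filter_false_of_mem fun m hm => by
    rw [not_not]; exact hvote m (Finset.mem_range.1 hm).le] at h1
  simp only [Finset.card_empty, mul_zero] at h1
  omega

/-- Pooled Allocation is consistent if the batches are long compared with their number. -/
lemma tendsto_recommend_pooledAllocation [NeZero K] {w : Allocation K} (hw : Measurable w)
    {B : ℕ → ℕ} (hB : IsBatchSchedule B)
    (hlong : Tendsto (fun T : ℕ => ((T / B T - K : ℕ) : ℝ) / B T) atTop atTop)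
    {Q : Fin K → ℝ} {j : Fin K} (hj : IsBest Q j) (hju : ∀ i, IsBest Q i → i = j) :
    Tendsto (fun T => noiseLaw.real {z | (pooledAllocation w hw B).recommend T
      (fun t : Fin T => (pooledAllocation w hw B).reward T Q z t) = j}) atTop (nhds 1) := by
  set A := pooledAllocation w hw B with hA
  obtain ⟨γ, hγ, hgap⟩ := exists_gap hj hju
  set S := (squareMoment (1 / 2)).toReal with hS
  have hfin : squareMoment (1 / 2) < ⊤ := squareMoment_lt_top (by norm_num)
  have hS1 : 1 ≤ S := by
    rw [hS, ← ENNReal.toReal_one]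
    exact ENNReal.toReal_mono hfin.ne (one_le_squareMoment (by norm_num))
  have hSeq : squareMoment (1 / 2) = ENNReal.ofReal (Real.exp (Real.log S)) := by
    rw [Real.exp_log (by linarith), hS, ENNReal.ofReal_toReal hfin.ne]
  -- Chernoff's bound with `a = 1/2` at energy `(n - K) γ² / 8`, with the factor `B` taken out of
  -- the exponent; the bracket tends to `-∞` exactly because `(n - K) / B` tends to infinity.
  have hup : Tendsto (fun T : ℕ => 1 - Real.exp ((B T : ℝ) *
      (K * Real.log S - γ ^ 2 / 16 * (((T / B T - K : ℕ) : ℝ) / B T)))) atTop (nhds 1) := by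
    have h1 : Tendsto (fun T : ℕ => K * Real.log S -
        γ ^ 2 / 16 * (((T / B T - K : ℕ) : ℝ) / B T)) atTop atBot := by
      have := tendsto_neg_atTop_atBot.comp (hlong.const_mul_atTop (show 0 < γ ^ 2 / 16 by positivity))
      exact tendsto_atBot_add_const_left _ _ this
    have h2 := Real.tendsto_exp_atBot.comp
      ((tendsto_natCast_atTop_atTop.comp hB.1).atTop_mul_atBot₀ h1)
    simpa using h2.const_sub 1
  refine tendsto_of_tendsto_of_tendsto_of_le_of_le' hup tendsto_const_nhds ?_
    (Eventually.of_forall fun T => measureReal_le_one)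
  filter_upwards [hB.eventually_lt K] with T hT
  have hproc := isPooledProcess_reward w hw B Q hT.2
  rw [← hA] at hproc
  set n := T / B T
  set F := {z | ((n - K : ℕ) : ℝ) * (γ ^ 2 / 8) ≤ energy w n (A.reward T Q z) z (B T - K)} with hF
  have hFm : MeasurableSet F := measurableSet_le measurable_const (hproc.measurable_energy _)
  have hFle : noiseLaw.real F ≤ Real.exp ((B T : ℝ) *
      (K * Real.log S - γ ^ 2 / 16 * (((n - K : ℕ) : ℝ) / B T))) := by
    refine ENNReal.toReal_le_of_le_ofReal (Real.exp_pos _).le ?_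
    refine (hproc.measure_le_energy (a := 1 / 2) (by norm_num) (B T - K) _).trans ?_
    rw [hSeq, ← ENNReal.ofReal_pow (Real.exp_pos _).le, ← Real.exp_nat_mul,
      ← ENNReal.ofReal_mul (Real.exp_pos _).le, ← Real.exp_add]
    refine ENNReal.ofReal_le_ofReal (Real.exp_le_exp.2 ?_)
    have hle : ((K * (B T - K + 1) : ℕ) : ℝ) ≤ K * B T := by
      have : 0 < K := NeZero.pos K
      exact_mod_cast Nat.mul_le_mul_left K (by omega : B T - K + 1 ≤ B T)
    have hlog := mul_le_mul_of_nonneg_right hle (Real.log_nonneg hS1)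
    have hB0 : (B T : ℝ) ≠ 0 := by
      have : B T ≠ 0 := by omega
      exact_mod_cast this
    have e : (B T : ℝ) * (K * Real.log S - γ ^ 2 / 16 * (((n - K : ℕ) : ℝ) / B T)) =
        K * B T * Real.log S - ((n - K : ℕ) : ℝ) * (γ ^ 2 / 16) := by
      field_simp
    rw [e]
    linarith
  have hsub : Fᶜ ⊆ {z | A.recommend T (fun t : Fin T => A.reward T Q z t) = j} := by
    intro z hz
    have hz' : energy w n (A.reward T Q z) z (B T - K) < ((n - K : ℕ) : ℝ) * (γ ^ 2 / 8) :=
      not_le.1 hz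
    have hrec := recommend_pooledAllocation hw B hT.2.le (A.reward T Q z)
    rw [← hA] at hrec
    change A.recommend T _ = j
    rw [hrec]
    exact (hproc.run z).argmax_victories_eq hT.2 hT.1 hγ hgap hz'
  have := measureReal_mono (μ := noiseLaw) hsub
  rw [probReal_compl_eq_one_sub hFm] at this
  linarith

/-! ### A batch schedule with long batches -/

lemma tendsto_sqrt_sqrt : Tendsto (fun T : ℕ => T.sqrt.sqrt) atTop atTop := by
  have h : Tendsto Nat.sqrt atTop atTop := by
    refine tendsto_atTop.2 fun b => ?_
    filter_upwards [eventually_ge_atTop (b * b)] with T hT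
    exact Nat.le_sqrt.2 hT
  exact h.comp h

lemma sqrt_sqrt_pow_le (T : ℕ) : T.sqrt.sqrt ^ 4 ≤ T := by
  have h1 := Nat.sqrt_le' T
  have h2 := Nat.sqrt_le' T.sqrt
  calc T.sqrt.sqrt ^ 4 = (T.sqrt.sqrt ^ 2) ^ 2 := by ring
    _ ≤ T.sqrt ^ 2 := Nat.pow_le_pow_left h2 2
    _ ≤ T := h1

lemma isBatchSchedule_sqrt_sqrt : IsBatchSchedule fun T => T.sqrt.sqrt := by
  refine ⟨tendsto_sqrt_sqrt, ?_⟩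
  refine (isLittleO_iff_tendsto' ?_).2 ?_
  · filter_upwards [eventually_gt_atTop 0] with T hT h
    exact absurd (Nat.cast_eq_zero.1 h) hT.ne'
  · have h0 : Tendsto (fun T : ℕ => ((T.sqrt.sqrt : ℕ) : ℝ)⁻¹) atTop (nhds 0) :=
      tendsto_inv_atTop_zero.comp (tendsto_natCast_atTop_atTop.comp tendsto_sqrt_sqrt)
    refine tendsto_of_tendsto_of_tendsto_of_le_of_le' tendsto_const_nhds h0
      (Eventually.of_forall fun T => by positivity) ?_
    filter_upwards [tendsto_sqrt_sqrt.eventually_gt_atTop 0, eventually_gt_atTop 0] with T hT hT0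
    have hT' : (0 : ℝ) < (T.sqrt.sqrt : ℕ) := by exact_mod_cast hT
    have hT0' : (0 : ℝ) < T := by exact_mod_cast hT0
    rw [div_le_iff₀ hT0', inv_mul_eq_div, le_div_iff₀ hT']
    have h1 : T.sqrt.sqrt * T.sqrt.sqrt ≤ T := by
      refine le_trans ?_ (sqrt_sqrt_pow_le T)
      rw [← pow_two]
      exact Nat.pow_le_pow_right hT (by norm_num)
    exact_mod_cast h1

/-- With `b` about `T^(1/4)` batches, `b ^ 4 ≤ T` gives batches of at least `b ^ 3` rounds, so the
ratio is at least `b - K`. -/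
lemma tendsto_long_batches (K : ℕ) :
    Tendsto (fun T : ℕ => ((T / T.sqrt.sqrt - K : ℕ) : ℝ) / (T.sqrt.sqrt : ℕ)) atTop atTop := by
  have h0 : Tendsto (fun T : ℕ => ((T.sqrt.sqrt : ℕ) : ℝ) - K) atTop atTop :=
    tendsto_atTop_add_const_right _ _ (tendsto_natCast_atTop_atTop.comp tendsto_sqrt_sqrt)
  refine tendsto_atTop_mono' _ ?_ h0
  filter_upwards [tendsto_sqrt_sqrt.eventually_gt_atTop 0] with T hT
  set b := T.sqrt.sqrt with hb
  have hb' : (1 : ℝ) ≤ b := by exact_mod_cast hT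
  have h1 : b ^ 3 ≤ T / b := by
    rw [Nat.le_div_iff_mul_le hT, ← pow_succ]
    exact sqrt_sqrt_pow_le T
  have h2 : ((b : ℝ)) ^ 3 ≤ ((T / b : ℕ) : ℝ) := by exact_mod_cast h1
  have h3 : ((T / b : ℕ) : ℝ) - K ≤ ((T / b - K : ℕ) : ℝ) := by
    rw [sub_le_iff_le_add]
    exact_mod_cast le_tsub_add
  rw [le_div_iff₀ (by linarith)]
  have hK : (0 : ℝ) ≤ K := Nat.cast_nonneg K
  have h4 : (K : ℝ) * 1 ≤ K * b := mul_le_mul_of_nonneg_left hb' hK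
  have h5 : (b : ℝ) * b ≤ b ^ 3 := by
    have : (0 : ℝ) ≤ b * b * (b - 1) := mul_nonneg (by positivity) (by linarith)
    linarith [this, (by ring : (b : ℝ) * b * (b - 1) = b ^ 3 - b * b)]
  linarith [(by ring : ((b : ℝ) - K) * b = b * b - K * b)]

end BestArm

end

/-! ### Assembly of the two bounds -/

open BestArm
theorem mainTheorem5 (K : ℕ) [NeZero K] (H : (Fin K → ℝ) → ℝ≥0∞)
    (hH : ∀ P, HasUniqueBest P → 0 < H P) :
    (∃ A : Algorithm K,
      (∃ (w : Allocation K) (hw : IsOptimalAllocation H w) (B : ℕ → ℕ),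
        IsBatchSchedule B ∧ A = pooledAllocation w hw.1 B) ∧
      (∀ ε : ℝ≥0, 0 < ε → (Rgo H - ε) / 2 ≤ A.rate H) ∧
      Rgo H / 2 ≤ A.rate H ∧ A.rate H ≤ Rgo H) ∧
    ∀ (w : Allocation K) (hw : IsOptimalAllocation H w) (B : ℕ → ℕ), IsBatchSchedule B →
      ∀ ε : ℝ≥0, 0 < ε → Rgo H / 2 - ε ≤ (pooledAllocation w hw.1 B).rate H := by
  have hlow : ∀ (w : Allocation K) (hw : IsOptimalAllocation H w) (B : ℕ → ℕ),
      IsBatchSchedule B → Rgo H / 2 ≤ (pooledAllocation w hw.1 B).rate H := by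
    intro w hw B hB
    exact (congrArg (· / 2) hw.2.symm).le.trans (half_gameValue_le_rate hH hw.1 hB)
  refine ⟨?_, fun w hw B hB ε _ => tsub_le_self.trans (hlow w hw B hB)⟩
  obtain ⟨w, hw⟩ := exists_isOptimalAllocation H
  have hB := isBatchSchedule_sqrt_sqrt
  have hhalf := hlow w hw _ hB
  refine ⟨_, ⟨w, hw, _, hB, rfl⟩, fun ε _ => ?_, hhalf, ?_⟩
  · exact (ENNReal.div_le_div_right tsub_le_self 2).trans hhalf
  -- The upper bound needs consistency, which is available for this schedule because its batches are
  -- long.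
  · exact Algorithm.rate_le_Rgo _ H fun Q j hj hju =>
      tendsto_recommend_pooledAllocation hw.1 hB (tendsto_long_batches K) hj hju
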